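/- Scale-free property of the model of independent edges. Let $N\ge 1$ be the number of edge types and let $G_0=(V_0,E_0)$ be a deterministic finite loopless multigraph with $|V_0|=s$ vertices, in which every edge has a type in $\{1,\dots,N\}$ and there is at least one edge of each type. Let $\lambda_1,\lambda_2,\dots$ be a sequence of independent, identically distributed, almost surely positive random variables, all of whose moments are finite, such that $$\sum_{l=1}^{\infty}\frac{\mathbb{E}(\lambda_1^l)}{l\cdot l!}z^l<\infty\quad\text{for some } z>1 .$$ Random graphs $G_0, G_1,G_2,\dots$ with typed edges are generated as follows; $V_n$ and $E_n$ denote the vertex set and the edge set of $G_n$, $\deg_n^{(k)}(v)$ the number of edges of type $k$ connected to $v$ in $G_n$, and $\mathcal{F}_n$ the $\sigma$-algebra generated by $G_0,\dots,G_n$. For every $n\ge 1$, $\lambda_n$ is independent of $\mathcal{F}_{n-1}$. In the $n$th step a new vertex $v_n$ is added, together with $\Delta_n^{(k)}(w)$ edges of type $k$ between $v_n$ and each $w\in V_{n-1}$; no other edges are added and none is deleted. Conditionally on $\sigma(\mathcal{F}_{n-1},\lambda_n)$, the random variables $\Delta_n^{(k)}(w)$ ($1\le k\le N$, $w\in V_{n-1}$)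 are independent, and $$\Delta_n^{(k)}(w)\sim\mathrm{Poi}\left(\lambda_n\frac{\deg_{n-1}^{(k)}(w)}{2|E_{n-1}|}\right).$$ Then the following hold. 1. For every type $k$ and every $l\ge 0$ there is a random variable $\hat x_l^{(k)}$ such that $$\frac{|\{v\in V_n:\deg_n^{(k)}(v)=l\}|}{|V_n|}\to \hat x_l^{(k)}\quad\text{almost surely as } n\to\infty .$$ Almost surely $\sum_{l\ge 0}\hat x_l^{(k)}=1$, and there is an almost surely positive random variable $\hat C_k$ such that, almost surely, $\hat x_l^{(k)}\,l^3\to\hat C_k$ as $l\to\infty$. 2. There are deterministic constants $\hat z_d$ $(d\ge 0)$ with $\sum_{d\ge 0}\hat z_d=1$ such that for every $d\ge 0$ $$\frac{|\{v\in V_n:\sum_{k=1}^N\deg_n^{(k)}(v)=d\}|}{|V_n|}\to\hat z_d\quad\text{almost surely as } n\to\infty ,$$ and a constant $\hat C>0$ such that $\hat z_d\,d^3\to\hat C$ as $d\to\infty$. That is, the per-type degree distributions and the total degree distribution are scale-free with characteristic exponent $3$. -/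

import Mathlib

open MeasureTheory ProbabilityTheory Filter Topology
open scoped Nat

/-- A finite graph on natural-number labelled vertices whose edges carry one of `N` types.
Multiple edges are allowed (the edges of each type form a multiset), loops are forbidden. -/
@[ext]
structure TypedGraph (N : ℕ) where
  verts : Finset ℕ
  edges : Fin N → Multiset (Sym2 ℕ)
  loopless : ∀ k, ∀ e ∈ edges k, ¬ e.IsDiag
  incident : ∀ k, ∀ e ∈ edges k, ∀ v ∈ e, v ∈ verts

namespace TypedGraph

variable {N : ℕ}

/-- The discrete σ-algebra (there are only countably many finite typed graphs). -/
instance instMeasurableSpace : MeasurableSpace (TypedGraph N) := ⊤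

/-- The number of edges of type `k`. -/
def edgeCount (G : TypedGraph N) (k : Fin N) : ℕ := (G.edges k).card

/-- The total number of edges. -/
def totalEdges (G : TypedGraph N) : ℕ := ∑ k, G.edgeCount k

/-- The number of edges of type `k` between `v` and `w`. -/
def mult (G : TypedGraph N) (k : Fin N) (v w : ℕ) : ℕ := (G.edges k).count s(v, w)

/-- The number of edges of type `k` connected to `v`. -/
def deg (G : TypedGraph N) (k : Fin N) (v : ℕ) : ℕ := (G.edges k).countP (fun e => v ∈ e)

/-- The number of vertices with exactly `l` edges of type `k` connected to them. -/
def numTypeDeg (G : TypedGraph N) (k : Fin N) (l : ℕ) : ℕ :=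
  (G.verts.filter (fun v => G.deg k v = l)).card

/-- The number of vertices with exactly `d` edges (of any type) connected to them. -/
def numTotalDeg (G : TypedGraph N) (d : ℕ) : ℕ :=
  (G.verts.filter (fun v => ∑ k, G.deg k v = d)).card

/-- `H` arises from `G` by adding the vertex `v` and some typed edges connected to `v`
(since loops are forbidden, the new edges lead to old vertices). -/
structure IsExtension (G H : TypedGraph N) (v : ℕ) : Prop where
  verts_eq : H.verts = insert v G.verts
  edges_le : ∀ k, G.edges k ≤ H.edges k
  new_edges : ∀ k, ∀ e ∈ H.edges k - G.edges k, v ∈ e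

end TypedGraph

/-- The σ-algebra `F n` generated by the graphs `G 0, …, G n` (in the model below `G 0` is
deterministic, so that `F 0` is trivial). -/
abbrev graphHistory {Ω : Type*} {N : ℕ} (G : ℕ → Ω → TypedGraph N) (n : ℕ) : MeasurableSpace Ω :=
  ⨆ m ∈ Set.Iic n, MeasurableSpace.comap (G m) inferInstance

/-- The σ-algebra `F⁺ n` generated by `F n` and `lam (n + 1)`. -/
abbrev graphHistoryPlus {Ω : Type*} {N : ℕ} (G : ℕ → Ω → TypedGraph N) (lam : ℕ → Ω → ℝ) (n : ℕ) :
    MeasurableSpace Ω :=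
  graphHistory G n ⊔ MeasurableSpace.comap (lam (n + 1)) inferInstance

/-- The `N`-type preferential attachment model of independent edges, started from the
deterministic graph `G₀` on the vertices `0, …, s - 1`, with parameters `lam 1, lam 2, …`
(`lam 0` is not used). The vertex born in step `n + 1` is labelled `s + n`. -/
structure IsIndependentEdgesModel {Ω : Type*} [MeasurableSpace Ω] (P : Measure Ω) {N : ℕ}
    (s : ℕ) (G₀ : TypedGraph N) (lam : ℕ → Ω → ℝ) (G : ℕ → Ω → TypedGraph N) : Prop where
  initial_verts : G₀.verts = Finset.range s
  initial_edges : ∀ k, 0 < G₀.edgeCount k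
  start : ∀ ω, G 0 ω = G₀
  measurable_graph : ∀ n, Measurable (G n)
  measurable_lam : ∀ n, Measurable (lam n)
  step : ∀ n ω, (G n ω).IsExtension (G (n + 1) ω) (s + n)
  lam_pos : ∀ n, ∀ᵐ ω ∂P, 0 < lam (n + 1) ω
  lam_indep : iIndepFun (fun n => lam (n + 1)) P
  lam_indep_history : ∀ n,
    Indep (MeasurableSpace.comap (lam (n + 1)) inferInstance) (graphHistory G n) P
  /-- Conditionally on `F⁺ n`, the numbers of edges of type `k` between the new vertex and the
  old vertices `w` are independent over all pairs `(k, w)` and Poisson distributed with parameter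
  `lam (n + 1) * deg k w / (2 |E n|)`. -/
  poisson : ∀ n, ∀ δ : Fin N → ℕ → ℕ,
    P⟦{ω | ∀ k, ∀ w ∈ Finset.range (s + n), (G (n + 1) ω).mult k (s + n) w = δ k w} |
        graphHistoryPlus G lam n⟧
      =ᵐ[P] fun ω => ∏ k, ∏ w ∈ Finset.range (s + n),
        (poissonMeasure (Real.toNNReal
          (lam (n + 1) ω * ((G n ω).deg k w : ℝ) / (2 * ((G n ω).totalEdges : ℝ))))).real {δ k w}

/-! Fix a set `S` of types; `S = {k}` gives the first claim and `S = Finset.univ` the second.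
Poisson variables add up, and the new parameter is independent of the history. So, given the past,
the number of new edges with type in `S` to a set `W` of old vertices is mixed Poisson: its rate is
the parameter, with law `ν`, times `rateIn S W` (`setLIntegral_comp_sum_multIn`). Let μ and μ₂ be
the first two moments of `ν`, ψ_j the weight `mixedPois ν j`, E_n the total edge number, p_n the
proportion of edges with type in `S`, and X_l(n) the number of vertices with `S`-degree l. Then
`hasCondExp_numDegIn` says E[X_l(n+1) | F_n] = Σ_{i+j=l} X_i(n) ψ_j(i/(2E_n)) + ψ_l(p_n).

A law of large numbers (an L² martingale with weights 1/n, then Kronecker's lemma) makes the noise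
average out and gives E_n/n → μ. Hence n(1 - ψ_0(i/(2E_n))) and nψ_1(i/(2E_n)) tend to i/2, while
nψ_j tends to 0 for j ≥ 2. If p_n → p, then X_l(n)/n → x_l, where (1 + l/2) x_l = ((l-1)/2) x_{l-1}
+ ψ_l(p) (`tendsto_div_degLimit`). Multiplied by 2l(l+1) the recursion telescopes to l(l+1)(l+2) x_l
= 2 Σ_{j≤l} j(j+1) ψ_j(p). So l³x_l tends to 2(2μp + μ₂p²), which is positive when p > 0.

For all types together p_n = 1, so the limit is deterministic. For a single type the remaining point
is that p_n has a positive limit (`ae_exists_pos_tendsto_rateIn`). Up to a term K/(number of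
`S`-edges), which absorbs the second-order error, -log p_n is a nonnegative supermartingale. It
therefore has a finite limit, and p_n cannot tend to 0. -/

/-! ### Poisson weights -/

/-- The Poisson weights, with the rate truncated at zero. -/
noncomputable def pois (m : ℕ) (x : ℝ) : ℝ := (poissonMeasure x.toNNReal).real {m}

lemma pois_eq_max (m : ℕ) (x : ℝ) :
    pois m x = Real.exp (-(max x 0)) * (max x 0) ^ m / (m ! : ℝ) := by
  rw [pois, poissonMeasure_real_singleton, Real.coe_toNNReal']

lemma pois_eq {m : ℕ} {x : ℝ} (hx : 0 ≤ x) :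
    pois m x = Real.exp (-x) * x ^ m / (m ! : ℝ) := by
  rw [pois_eq_max, max_eq_left hx]

lemma pois_nonneg (m : ℕ) (x : ℝ) : 0 ≤ pois m x := measureReal_nonneg

lemma pois_le_one (m : ℕ) (x : ℝ) : pois m x ≤ 1 := measureReal_le_one

lemma continuous_pois (m : ℕ) : Continuous (pois m) := by
  have : pois m = fun x => Real.exp (-(max x 0)) * (max x 0) ^ m / (m ! : ℝ) :=
    funext (pois_eq_max m)
  rw [this]
  fun_prop

lemma pois_succ {m : ℕ} {x : ℝ} (hx : 0 ≤ x) :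
    ((m + 1 : ℕ) : ℝ) * pois (m + 1) x = x * pois m x := by
  rw [pois_eq hx, pois_eq hx, Nat.factorial_succ]
  have := Nat.factorial_ne_zero m
  push_cast
  field_simp
  ring

lemma hasSum_pois {x : ℝ} (hx : 0 ≤ x) : HasSum (fun m => pois m x) 1 := by
  have h := hasSum_one_poissonMeasure x.toNNReal
  rw [Real.coe_toNNReal x hx] at h
  simpa only [pois_eq hx] using h

lemma hasSum_of_succ {f : ℕ → ℝ} {a : ℝ} (h0 : f 0 = 0) (h : HasSum (fun m => f (m + 1)) a) :
    HasSum f a := by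
  have := (hasSum_nat_add_iff (f := f) 1).1 h
  simpa [h0] using this

lemma hasSum_mul_pois {x : ℝ} (hx : 0 ≤ x) : HasSum (fun m : ℕ => (m : ℝ) * pois m x) x := by
  refine hasSum_of_succ (by simp) ?_
  simp only [pois_succ hx]
  simpa using (hasSum_pois hx).mul_left x

lemma hasSum_sq_mul_pois {x : ℝ} (hx : 0 ≤ x) :
    HasSum (fun m : ℕ => (m : ℝ) ^ 2 * pois m x) (x + x ^ 2) := by
  refine hasSum_of_succ (by simp) ?_
  have h : (fun m : ℕ => ((m + 1 : ℕ) : ℝ) ^ 2 * pois (m + 1) x) =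
      fun m : ℕ => x * ((m : ℝ) * pois m x) + x * pois m x := by
    funext m
    rw [sq, mul_assoc, pois_succ hx]
    push_cast
    ring
  rw [h]
  have e : x + x ^ 2 = x * x + x * 1 := by ring
  rw [e]
  exact ((hasSum_mul_pois hx).mul_left x).add ((hasSum_pois hx).mul_left x)

lemma pois_zero {x : ℝ} (hx : 0 ≤ x) : pois 0 x = Real.exp (-x) := by simp [pois_eq hx]

lemma abs_one_sub_pois_zero_sub_le {x : ℝ} (hx : 0 ≤ x) : |1 - pois 0 x - x| ≤ x ^ 2 := by
  rw [pois_zero hx, abs_le]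
  have h1 : 1 - x ≤ Real.exp (-x) := by linarith [Real.add_one_le_exp (-x)]
  have h2 : Real.exp (-x) * (1 + x) ≤ 1 := by
    have : Real.exp (-x) * Real.exp x = 1 := by rw [← Real.exp_add]; simp
    nlinarith [Real.add_one_le_exp x, Real.exp_pos (-x)]
  have h3 : Real.exp (-x) ≤ 1 := Real.exp_le_one_iff.2 (by linarith)
  constructor <;> nlinarith [mul_nonneg hx (sub_nonneg.2 h3)]

lemma abs_pois_one_sub_le {x : ℝ} (hx : 0 ≤ x) : |pois 1 x - x| ≤ x ^ 2 := by
  have h : pois 1 x = Real.exp (-x) * x := by simp [pois_eq hx]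
  have h1 : 1 - x ≤ Real.exp (-x) := by linarith [Real.add_one_le_exp (-x)]
  have h3 : Real.exp (-x) ≤ 1 := Real.exp_le_one_iff.2 (by linarith)
  rw [h, abs_le]
  constructor <;> nlinarith [mul_nonneg hx (sub_nonneg.2 h3), mul_le_mul_of_nonneg_right h1 hx]

lemma pois_add_two_le (m : ℕ) {x : ℝ} (hx : 0 ≤ x) : pois (m + 2) x ≤ x ^ 2 := by
  have h1 := pois_succ (m := m + 1) hx
  have h2 := pois_succ (m := m) hx
  have h3 := pois_le_one m x
  have h4 : pois (m + 1) x ≤ x := by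
    have := mul_le_mul_of_nonneg_left h3 hx
    have h5 := pois_nonneg (m + 1) x
    push_cast at h2
    nlinarith [mul_nonneg (Nat.cast_nonneg (α := ℝ) m) h5]
  have h5 := pois_nonneg (m + 2) x
  push_cast at h1
  nlinarith [mul_nonneg (Nat.cast_nonneg (α := ℝ) m) h5]

/-- Convexity of `exp` between 0 and -x. In the Lyapunov argument this bounds the chance of at least
one new edge from below, linearly in p. -/
lemma pois_zero_le {x p : ℝ} (hx : 0 ≤ x) (hp0 : 0 ≤ p) (hp1 : p ≤ 1) :
    pois 0 (x * p) ≤ 1 - p * (1 - pois 0 x) := by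
  rw [pois_zero hx, pois_zero (mul_nonneg hx hp0)]
  have h := convexOn_exp.2 (Set.mem_univ (0 : ℝ)) (Set.mem_univ (-x)) (sub_nonneg.2 hp1) hp0
    (by ring)
  simp only [smul_eq_mul, mul_zero, zero_add, Real.exp_zero, mul_one] at h
  rw [show p * -x = -(x * p) by ring] at h
  linarith

lemma lintegral_poissonMeasure_eq {f : ℕ → ℝ} {x a : ℝ} (hf : ∀ m, 0 ≤ f m)
    (h : HasSum (fun m => f m * pois m x) a) :
    ∫⁻ m, ENNReal.ofReal (f m) ∂poissonMeasure x.toNNReal = ENNReal.ofReal a := by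
  rw [lintegral_countable']
  have : ∀ m : ℕ, ENNReal.ofReal (f m) * poissonMeasure x.toNNReal {m} =
      ENNReal.ofReal (f m * pois m x) := fun m => by
    rw [ENNReal.ofReal_mul (hf m), pois, ofReal_measureReal]
  simp only [this]
  rw [← ENNReal.ofReal_tsum_of_nonneg (fun m => mul_nonneg (hf m) (pois_nonneg m x)) h.summable,
    h.tsum_eq]

/-! ### Mixed Poisson weights -/

/-- The weights of the mixed Poisson distribution with rate `x * r`, `x` distributed as `ν`. -/
noncomputable def mixedPois (ν : Measure ℝ) (m : ℕ) (r : ℝ) : ℝ := ∫ x, pois m (x * r) ∂ν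

/-- The mean of `f` with respect to the mixed Poisson distribution. -/
noncomputable def mixedPoisMean (ν : Measure ℝ) (f : ℕ → ENNReal) (r : ℝ) : ENNReal :=
  ∫⁻ x, ∫⁻ m, f m ∂poissonMeasure (x * r).toNNReal ∂ν

section Mixed

variable {ν : Measure ℝ}

lemma mixedPois_nonneg (m : ℕ) (r : ℝ) : 0 ≤ mixedPois ν m r :=
  integral_nonneg fun _ => pois_nonneg _ _

/-- Common source of the mean, second moment and point masses: a closed form `g` of the Poisson mean
of `f` only has to be integrated over `ν`. -/
lemma mixedPoisMean_eq {f : ℕ → ℝ} {g : ℝ → ℝ} (hν : ∀ᵐ x ∂ν, 0 < x) (hf : ∀ m, 0 ≤ f m)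
    (h : ∀ x, 0 ≤ x → HasSum (fun m => f m * pois m x) (g x)) {r : ℝ} (hr : 0 ≤ r)
    (hg : Integrable (fun x => g (x * r)) ν) :
    mixedPoisMean ν (fun m => ENNReal.ofReal (f m)) r = ENNReal.ofReal (∫ x, g (x * r) ∂ν) := by
  rw [ofReal_integral_eq_lintegral_ofReal hg]
  · refine lintegral_congr_ae (hν.mono fun x hx => ?_)
    exact lintegral_poissonMeasure_eq hf (h _ (mul_nonneg hx.le hr))
  · refine hν.mono fun x hx => ?_
    exact (h _ (mul_nonneg hx.le hr)).nonneg fun m => mul_nonneg (hf m) (pois_nonneg _ _)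

lemma mixedPoisMean_id (hν : ∀ᵐ x ∂ν, 0 < x) (h1 : Integrable (fun x => x) ν) {r : ℝ}
    (hr : 0 ≤ r) :
    mixedPoisMean ν (fun j => ENNReal.ofReal j) r = ENNReal.ofReal ((∫ x, x ∂ν) * r) := by
  rw [mixedPoisMean_eq (g := fun x => x) hν (fun j => Nat.cast_nonneg j)
    (fun x hx => hasSum_mul_pois hx) hr (h1.mul_const r), integral_mul_const]

lemma mixedPoisMean_sq (hν : ∀ᵐ x ∂ν, 0 < x) (h1 : Integrable (fun x => x) ν)
    (h2 : Integrable (fun x => x ^ 2) ν) {r : ℝ} (hr : 0 ≤ r) :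
    mixedPoisMean ν (fun j => ENNReal.ofReal ((j : ℝ) ^ 2)) r =
      ENNReal.ofReal ((∫ x, x ∂ν) * r + (∫ x, x ^ 2 ∂ν) * r ^ 2) := by
  rw [mixedPoisMean_eq (g := fun x => x + x ^ 2) hν (fun j => by positivity)
    (fun x hx => hasSum_sq_mul_pois hx) hr]
  · rw [integral_add (h1.mul_const r), integral_mul_const]
    · simp only [mul_pow, integral_mul_const]
    · simpa only [mul_pow] using h2.mul_const (r ^ 2)
  · refine (h1.mul_const r).add ?_
    simpa only [mul_pow] using h2.mul_const (r ^ 2)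

variable [IsProbabilityMeasure ν]

lemma integrable_pois (m : ℕ) (r : ℝ) : Integrable (fun x => pois m (x * r)) ν := by
  refine Integrable.of_bound (C := 1)
    ((continuous_pois m).comp (continuous_mul_const r)).aestronglyMeasurable
    (Eventually.of_forall fun x => ?_)
  rw [Real.norm_of_nonneg (pois_nonneg _ _)]
  exact pois_le_one _ _

lemma mixedPois_le_one (m : ℕ) (r : ℝ) : mixedPois ν m r ≤ 1 := by
  have := integral_mono (μ := ν) (integrable_pois m r) (integrable_const (1 : ℝ))
    (fun x => pois_le_one m (x * r))
  simpa [mixedPois] using this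

lemma continuous_mixedPois (m : ℕ) : Continuous (mixedPois ν m) := by
  refine continuous_of_dominated (bound := fun _ => 1)
    (fun r => ((continuous_pois m).comp (continuous_mul_const r)).aestronglyMeasurable)
    (fun r => Eventually.of_forall fun x => ?_) (integrable_const _)
    (Eventually.of_forall fun x => (continuous_pois m).comp (continuous_const_mul x))
  rw [Real.norm_of_nonneg (pois_nonneg _ _)]
  exact pois_le_one _ _

lemma mixedPoisMean_single (hν : ∀ᵐ x ∂ν, 0 < x) (m : ℕ) {r : ℝ} (hr : 0 ≤ r) :
    mixedPoisMean ν (fun j => ENNReal.ofReal (if j = m then 1 else 0)) r =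
      ENNReal.ofReal (mixedPois ν m r) := by
  refine mixedPoisMean_eq (g := pois m) hν (fun j => by split_ifs <;> simp) (fun x hx => ?_) hr
    (integrable_pois m r)
  convert hasSum_ite_eq m (pois m x) using 2 with j
  split_ifs with h <;> simp [h]

/-- Sum and integral commute because the nonnegative terms dominate themselves and add up to an
integrable function. -/
lemma hasSum_integral_of_pois {f : ℕ → ℝ} {g : ℝ → ℝ} (hν : ∀ᵐ x ∂ν, 0 < x) (hf : ∀ m, 0 ≤ f m)
    (h : ∀ x, 0 ≤ x → HasSum (fun m => f m * pois m x) (g x)) {r : ℝ} (hr : 0 ≤ r)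
    (hg : Integrable (fun x => g (x * r)) ν) :
    HasSum (fun m => f m * mixedPois ν m r) (∫ x, g (x * r) ∂ν) := by
  have key : ∀ m, ∫ x, f m * pois m (x * r) ∂ν = f m * mixedPois ν m r := fun m =>
    integral_const_mul _ _
  simp only [← key]
  have hs : ∀ᵐ x ∂ν, HasSum (fun m => f m * pois m (x * r)) (g (x * r)) :=
    hν.mono fun x hx => h _ (mul_nonneg hx.le hr)
  refine hasSum_integral_of_dominated_convergence (fun m x => f m * pois m (x * r))
    (fun m => ((integrable_pois m r).const_mul (f m)).aestronglyMeasurable)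
    (fun m => Eventually.of_forall fun x => ?_) (hs.mono fun x hx => hx.summable) ?_ hs
  · rw [Real.norm_of_nonneg (mul_nonneg (hf m) (pois_nonneg _ _))]
  · exact hg.congr (hs.mono fun x hx => hx.tsum_eq.symm)

lemma hasSum_mixedPois (hν : ∀ᵐ x ∂ν, 0 < x) {r : ℝ} (hr : 0 ≤ r) :
    HasSum (fun m => mixedPois ν m r) 1 := by
  have := hasSum_integral_of_pois (ν := ν) (f := fun _ => 1) (g := fun _ => 1) hν
    (fun _ => zero_le_one) (fun x hx => by simpa using hasSum_pois hx) hr (integrable_const _)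
  simpa using this

/-- The weight m(m+1) is the one that makes the degree recursion telescope; twice this sum is the
tail constant. -/
lemma hasSum_mul_mixedPois (hν : ∀ᵐ x ∂ν, 0 < x) (h1 : Integrable (fun x => x) ν)
    (h2 : Integrable (fun x => x ^ 2) ν) {r : ℝ} (hr : 0 ≤ r) :
    HasSum (fun m : ℕ => (m : ℝ) * (m + 1) * mixedPois ν m r)
      (2 * (∫ x, x ∂ν) * r + (∫ x, x ^ 2 ∂ν) * r ^ 2) := by
  have hi2 : Integrable (fun x => (x * r) ^ 2) ν := by
    simpa only [mul_pow] using h2.mul_const (r ^ 2)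
  have hi1 : Integrable (fun x => 2 * (x * r)) ν := (h1.mul_const r).const_mul 2
  convert hasSum_integral_of_pois (ν := ν) (f := fun m => (m : ℝ) * (m + 1))
    (g := fun x => 2 * x + x ^ 2) hν (fun _ => by positivity) (fun x hx => ?_) hr
    (hi1.add hi2) using 1
  · rw [integral_add hi1 hi2, integral_const_mul, integral_mul_const]
    simp only [mul_pow, integral_mul_const]
    ring
  · convert (hasSum_mul_pois hx).add (hasSum_sq_mul_pois hx) using 1
    · funext m; ring
    · ring

lemma abs_one_sub_mixedPois_zero_sub_le (hν : ∀ᵐ x ∂ν, 0 < x) (h1 : Integrable (fun x => x) ν)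
    (h2 : Integrable (fun x => x ^ 2) ν) {r : ℝ} (hr : 0 ≤ r) :
    |1 - mixedPois ν 0 r - (∫ x, x ∂ν) * r| ≤ (∫ x, x ^ 2 ∂ν) * r ^ 2 := by
  have hi2 : Integrable (fun x => (x * r) ^ 2) ν := by
    simpa only [mul_pow] using h2.mul_const (r ^ 2)
  have e1 : 1 - mixedPois ν 0 r - (∫ x, x ∂ν) * r = ∫ x, (1 - pois 0 (x * r) - x * r) ∂ν := by
    have hi : Integrable (fun x => 1 - pois 0 (x * r)) ν :=
      (integrable_const _).sub (integrable_pois 0 r)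
    rw [integral_sub hi (h1.mul_const r),
      integral_sub (integrable_const _) (integrable_pois 0 r), integral_mul_const]
    simp [mixedPois]
  have e2 : (∫ x, x ^ 2 ∂ν) * r ^ 2 = ∫ x, (x * r) ^ 2 ∂ν := by
    simp only [mul_pow, integral_mul_const]
  rw [e1, e2, ← Real.norm_eq_abs]
  exact norm_integral_le_of_norm_le hi2 (hν.mono fun x hx =>
    abs_one_sub_pois_zero_sub_le (mul_nonneg hx.le hr))

lemma abs_mixedPois_one_sub_le (hν : ∀ᵐ x ∂ν, 0 < x) (h1 : Integrable (fun x => x) ν)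
    (h2 : Integrable (fun x => x ^ 2) ν) {r : ℝ} (hr : 0 ≤ r) :
    |mixedPois ν 1 r - (∫ x, x ∂ν) * r| ≤ (∫ x, x ^ 2 ∂ν) * r ^ 2 := by
  have hi2 : Integrable (fun x => (x * r) ^ 2) ν := by
    simpa only [mul_pow] using h2.mul_const (r ^ 2)
  have e1 : mixedPois ν 1 r - (∫ x, x ∂ν) * r = ∫ x, (pois 1 (x * r) - x * r) ∂ν := by
    rw [integral_sub (integrable_pois 1 r) (h1.mul_const r), integral_mul_const]
    simp [mixedPois]
  have e2 : (∫ x, x ^ 2 ∂ν) * r ^ 2 = ∫ x, (x * r) ^ 2 ∂ν := by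
    simp only [mul_pow, integral_mul_const]
  rw [e1, e2, ← Real.norm_eq_abs]
  exact norm_integral_le_of_norm_le hi2 (hν.mono fun x hx =>
    abs_pois_one_sub_le (mul_nonneg hx.le hr))

lemma mixedPois_add_two_le (hν : ∀ᵐ x ∂ν, 0 < x) (h2 : Integrable (fun x => x ^ 2) ν) (m : ℕ)
    {r : ℝ} (hr : 0 ≤ r) : mixedPois ν (m + 2) r ≤ (∫ x, x ^ 2 ∂ν) * r ^ 2 := by
  have hi2 : Integrable (fun x => (x * r) ^ 2) ν := by
    simpa only [mul_pow] using h2.mul_const (r ^ 2)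
  have e2 : (∫ x, x ^ 2 ∂ν) * r ^ 2 = ∫ x, (x * r) ^ 2 ∂ν := by
    simp only [mul_pow, integral_mul_const]
  rw [e2]
  exact integral_mono_ae (integrable_pois _ r) hi2 (hν.mono fun x hx =>
    pois_add_two_le m (mul_nonneg hx.le hr))

lemma mixedPois_zero_le (hν : ∀ᵐ x ∂ν, 0 < x) {p : ℝ} (hp0 : 0 ≤ p) (hp1 : p ≤ 1) :
    mixedPois ν 0 p ≤ 1 - p * (1 - mixedPois ν 0 1) := by
  have hi : Integrable (fun x => pois 0 x) ν := by simpa using integrable_pois (ν := ν) 0 1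
  have e : 1 - p * (1 - mixedPois ν 0 1) = ∫ x, (1 - p * (1 - pois 0 x)) ∂ν := by
    have hi' : Integrable (fun x => p * (1 - pois 0 x)) ν :=
      ((integrable_const _).sub hi).const_mul p
    rw [integral_sub (integrable_const _) hi',
      integral_const_mul, integral_sub (integrable_const _) hi]
    simp [mixedPois]
  rw [e]
  exact integral_mono_ae (integrable_pois _ p)
    ((integrable_const _).sub (((integrable_const _).sub hi).const_mul p))
    (hν.mono fun x hx => pois_zero_le hx.le hp0 hp1)

/-- Strictness comes from exp(-x) < 1 for `ν`-almost every x; it lets the Lyapunov constant have `1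
- mixedPois ν 0 1` as denominator. -/
lemma mixedPois_zero_one_lt (hν : ∀ᵐ x ∂ν, 0 < x) : mixedPois ν 0 1 < 1 := by
  have hi : Integrable (fun x => pois 0 (x * 1)) ν := integrable_pois 0 1
  have h : 0 < ∫ x, (1 - pois 0 (x * 1)) ∂ν := by
    rw [integral_pos_iff_support_of_nonneg_ae (Eventually.of_forall fun x =>
      sub_nonneg.2 (pois_le_one _ _)) ((integrable_const _).sub hi)]
    have : Function.support (fun x => 1 - pois 0 (x * 1)) =ᵐ[ν] Set.univ := by
      refine hν.mono fun x hx => ?_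
      have : (1 - pois 0 (x * 1)) ≠ 0 := by
        rw [mul_one, pois_zero hx.le]
        have : Real.exp (-x) < 1 := by
          rw [← Real.exp_zero]; exact Real.exp_lt_exp.2 (by linarith)
        linarith
      exact eq_true this
    rw [measure_congr this]
    simp
  rw [integral_sub (integrable_const _) hi] at h
  simpa [mixedPois] using h

lemma integral_pos_of_ae_pos (hν : ∀ᵐ x ∂ν, 0 < x) (h1 : Integrable (fun x => x) ν) :
    0 < ∫ x, x ∂ν := by
  rw [integral_pos_iff_support_of_nonneg_ae (hν.mono fun x hx => hx.le) h1]
  have : Function.support (fun x : ℝ => x) =ᵐ[ν] Set.univ :=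
    hν.mono fun x hx => eq_true (ne_of_gt hx)
  rw [measure_congr this]
  simp

end Mixed

/-! ### The limiting degree distribution -/

/-- The solution of the recursion `(l + 2) x l = (l - 1) x (l - 1) + 2 q l`. -/
noncomputable def degLimit (q : ℕ → ℝ) : ℕ → ℝ
  | 0 => q 0
  | l + 1 => (l * degLimit q l + 2 * q (l + 1)) / (l + 3)

lemma degLimit_nonneg {q : ℕ → ℝ} (hq : ∀ l, 0 ≤ q l) (l : ℕ) : 0 ≤ degLimit q l := by
  induction l with
  | zero => exact hq 0
  | succ l ih => rw [degLimit]; have := hq (l + 1); positivity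

/-- Multiplied by l(l+1), the recursion makes l(l+1)(l+2) x_l increase by exactly 2l(l+1) q_l. -/
lemma degLimit_mul (q : ℕ → ℝ) (l : ℕ) :
    (l : ℝ) * (l + 1) * (l + 2) * degLimit q l =
      2 * ∑ j ∈ Finset.range (l + 1), (j : ℝ) * (j + 1) * q j := by
  induction l with
  | zero => simp
  | succ l ih =>
    rw [Finset.sum_range_succ, mul_add 2, ← ih, degLimit]
    push_cast
    field_simp
    ring

/-- The recursion reads 2x_l + (l x_l - (l-1) x_{l-1}) = 2q_l, and the bracket telescopes. -/
lemma sum_degLimit (q : ℕ → ℝ) (l : ℕ) :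
    2 * ∑ i ∈ Finset.range (l + 1), degLimit q i + l * degLimit q l =
      2 * ∑ i ∈ Finset.range (l + 1), q i := by
  induction l with
  | zero => simp [degLimit]
  | succ l ih =>
    rw [Finset.sum_range_succ, Finset.sum_range_succ q, mul_add, mul_add, ← ih, degLimit]
    push_cast
    field_simp
    ring

lemma tendsto_degLimit_mul_cube {q : ℕ → ℝ} {M : ℝ}
    (hM : HasSum (fun j : ℕ => (j : ℝ) * (j + 1) * q j) M) :
    Tendsto (fun l : ℕ => degLimit q l * (l : ℝ) ^ 3) atTop (𝓝 (2 * M)) := by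
  have h1 : Tendsto (fun l : ℕ => (l : ℝ) * (l + 1) * (l + 2) * degLimit q l) atTop
      (𝓝 (2 * M)) := by
    simp only [degLimit_mul]
    exact ((hM.tendsto_sum_nat).comp (tendsto_add_atTop_nat 1)).const_mul 2
  have h2 : ∀ c : ℝ, Tendsto (fun l : ℕ => (l : ℝ) / (l + c)) atTop (𝓝 1) := fun c =>
    tendsto_natCast_div_add_atTop c
  have h3 := (h1.mul (h2 1)).mul (h2 2)
  simp only [mul_one] at h3
  refine h3.congr fun l => ?_
  field_simp

/-- No mass escapes: cubic decay kills the boundary term l x_l in `sum_degLimit`. -/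
lemma hasSum_degLimit {q : ℕ → ℝ} {M : ℝ} (hq : ∀ l, 0 ≤ q l) (h1 : HasSum q 1)
    (hM : HasSum (fun j : ℕ => (j : ℝ) * (j + 1) * q j) M) : HasSum (degLimit q) 1 := by
  rw [hasSum_iff_tendsto_nat_of_nonneg (degLimit_nonneg hq), ← tendsto_add_atTop_iff_nat 1]
  have hl : Tendsto (fun l : ℕ => (l : ℝ) * degLimit q l) atTop (𝓝 0) := by
    have h := (tendsto_degLimit_mul_cube hM).mul
      ((tendsto_inv_atTop_nhds_zero_nat (𝕜 := ℝ)).pow 2)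
    simp only [ne_eq, OfNat.ofNat_ne_zero, not_false_eq_true, zero_pow, mul_zero] at h
    refine h.congr fun l => ?_
    rcases Nat.eq_zero_or_pos l with rfl | hl
    · simp
    · field_simp
  have hs := (h1.tendsto_sum_nat).comp (tendsto_add_atTop_nat 1)
  have := hs.sub (hl.const_mul (1 / 2))
  simp only [mul_zero, sub_zero] at this
  refine this.congr fun l => ?_
  have := sum_degLimit q l
  simp only [Function.comp]
  linarith

/-! ### Averages -/

/-- Summation by parts. -/
lemma sum_range_eq_mul_sub_sum (d : ℕ → ℝ) (n : ℕ) :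
    ∑ i ∈ Finset.range n, d i =
      n * ∑ i ∈ Finset.range n, d i / ((i : ℝ) + 1) -
        ∑ j ∈ Finset.range n, ∑ i ∈ Finset.range j, d i / ((i : ℝ) + 1) := by
  induction n with
  | zero => simp
  | succ n ih =>
    rw [Finset.sum_range_succ, ih, Finset.sum_range_succ _ n,
      Finset.sum_range_succ (fun j => ∑ i ∈ Finset.range j, d i / ((i : ℝ) + 1)) n]
    push_cast
    field_simp
    ring

/-- Kronecker's lemma. -/
lemma tendsto_average_of_tendsto_sum_div {d : ℕ → ℝ} {L : ℝ}
    (h : Tendsto (fun n => ∑ i ∈ Finset.range n, d i / ((i : ℝ) + 1)) atTop (𝓝 L)) :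
    Tendsto (fun n : ℕ => (n : ℝ)⁻¹ * ∑ i ∈ Finset.range n, d i) atTop (𝓝 0) := by
  -- After division by n, summation by parts leaves the partial sum minus its Cesàro mean, and both
  -- tend to `L`.
  have := h.sub h.cesaro
  rw [sub_self] at this
  refine this.congr' ?_
  filter_upwards [eventually_gt_atTop 0] with n hn
  rw [sum_range_eq_mul_sub_sum d n]
  field_simp

/-- Factors in [0, 1] never amplify earlier errors, so |e_n| is at most |e_0| plus the sum of the
|ε_i|, which is o(n) by Cesàro. -/
lemma tendsto_div_of_contraction {e ε α : ℕ → ℝ} (hα0 : ∀ n, 0 ≤ α n) (hα1 : ∀ n, α n ≤ 1)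
    (he : ∀ n, e (n + 1) = α n * e n + ε n) (hε : Tendsto ε atTop (𝓝 0)) :
    Tendsto (fun n : ℕ => e n / n) atTop (𝓝 0) := by
  have hb : ∀ n, |e n| ≤ |e 0| + ∑ i ∈ Finset.range n, |ε i| := by
    intro n
    induction n with
    | zero => simp
    | succ n ih =>
      rw [Finset.sum_range_succ, he]
      refine (abs_add_le _ _).trans ?_
      have : |α n * e n| ≤ |e n| := by
        rw [abs_mul, abs_of_nonneg (hα0 n)]
        exact mul_le_of_le_one_left (abs_nonneg _) (hα1 n)
      linarith
  have h0 : Tendsto (fun n : ℕ => (n : ℝ)⁻¹ * |e 0| + (n : ℝ)⁻¹ * ∑ i ∈ Finset.range n, |ε i|)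
      atTop (𝓝 0) := by
    have h1 := (tendsto_inv_atTop_nhds_zero_nat (𝕜 := ℝ)).mul_const |e 0|
    have h2 : Tendsto (fun n => |ε n|) atTop (𝓝 0) := by simpa using hε.abs
    simpa using h1.add h2.cesaro
  refine squeeze_zero_norm (fun n => ?_) h0
  rw [norm_div, Real.norm_eq_abs, Real.norm_natCast, div_eq_inv_mul, ← mul_add]
  exact mul_le_mul_of_nonneg_left (hb n) (by positivity)

/-- Asymptotics of a linear recursion with noise that averages out. -/
lemma tendsto_div_of_recursion {u α b d : ℕ → ℝ} {a β : ℝ} (ha : 0 ≤ a)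
    (hα0 : ∀ n, 0 ≤ α n) (hα1 : ∀ n, α n ≤ 1)
    (hα : Tendsto (fun n : ℕ => (n : ℝ) * (1 - α n)) atTop (𝓝 a)) (hb : Tendsto b atTop (𝓝 β))
    (hd : Tendsto (fun n : ℕ => (n : ℝ)⁻¹ * ∑ i ∈ Finset.range n, d i) atTop (𝓝 0))
    (hu : ∀ n, u (n + 1) = α n * u n + b n + d n) :
    Tendsto (fun n : ℕ => u n / n) atTop (𝓝 (β / (1 + a))) := by
  set c := β / (1 + a) with hc
  set D : ℕ → ℝ := fun n => ∑ i ∈ Finset.range n, d i with hD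
  have hc' : β - c - c * a = 0 := by
    rw [hc]; field_simp; ring
  -- Removing the accumulated noise `D n` and the expected growth `c * n` leaves a contraction. The
  -- value of `c` is the one for which the new error tends to β - c - ca = 0.
  have h := tendsto_div_of_contraction (e := fun n => u n - D n - c * n)
    (ε := fun n => b n - c - c * (n * (1 - α n)) - n * (1 - α n) * ((n : ℝ)⁻¹ * D n)) hα0 hα1
    (fun n => ?_) ?_
  · have h2 := (h.add hd).add_const c
    simp only [zero_add] at h2
    refine h2.congr' ?_
    filter_upwards [eventually_gt_atTop 0] with n hn
    field_simp
    ring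
  · have : D (n + 1) = D n + d n := Finset.sum_range_succ _ _
    -- At n = 0 the factors n and n⁻¹ do not cancel, but `D 0 = 0`.
    rcases Nat.eq_zero_or_pos n with rfl | hn
    · simp [hu, hD]
      ring
    · rw [hu, this]
      push_cast
      field_simp
      ring
  · have := ((hb.sub_const c).sub (hα.const_mul c)).sub (hα.mul hd)
    rw [mul_zero, sub_zero, hc'] at this
    exact this

/-! ### A law of large numbers for adapted sequences -/

section LawOfLargeNumbers

variable {Ω : Type*} {mΩ : MeasurableSpace Ω} {P : Measure Ω} [IsProbabilityMeasure P]
  {ℱ : Filtration ℕ mΩ}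

/-- Pythagoras: the conditional expectation is orthogonal to the residual, so centring can only
lower the second moment. -/
lemma integral_sq_sub_condExp_le {m : MeasurableSpace Ω} (hm : m ≤ mΩ) {X : Ω → ℝ}
    (hX : MemLp X 2 P) :
    ∫ ω, (X ω - (P[X|m]) ω) ^ 2 ∂P ≤ ∫ ω, X ω ^ 2 ∂P := by
  have hXi : Integrable X P := hX.integrable one_le_two
  have hc : MemLp (P[X|m]) 2 P := hX.condExp one_le_two
  have h1 : Integrable (fun ω => (P[X|m]) ω * X ω) P := hc.integrable_mul hX
  have h3 : ∫ ω, (P[X|m]) ω * X ω ∂P = ∫ ω, (P[X|m]) ω ^ 2 ∂P := by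
    rw [← integral_condExp hm]
    refine integral_congr_ae ?_
    filter_upwards [condExp_mul_of_stronglyMeasurable_left (m := m) stronglyMeasurable_condExp
      h1 hXi] with ω hω
    have : (P[fun ω => (P[X|m]) ω * X ω|m]) ω = (P[(P[X|m]) * X|m]) ω := rfl
    rw [this, hω, Pi.mul_apply, sq]
  have h4 : ∫ ω, (X ω - (P[X|m]) ω) ^ 2 ∂P =
      ∫ ω, X ω ^ 2 ∂P - 2 * ∫ ω, (P[X|m]) ω * X ω ∂P + ∫ ω, (P[X|m]) ω ^ 2 ∂P := by
    have h2 : Integrable (fun ω => X ω ^ 2 - 2 * ((P[X|m]) ω * X ω)) P :=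
      hX.integrable_sq.sub (h1.const_mul 2)
    rw [← integral_const_mul, ← integral_sub hX.integrable_sq (h1.const_mul 2),
      ← integral_add h2 hc.integrable_sq]
    refine integral_congr_ae (Eventually.of_forall fun ω => ?_)
    ring
  have h5 : 0 ≤ ∫ ω, (P[X|m]) ω ^ 2 ∂P := integral_nonneg fun ω => sq_nonneg _
  rw [h4, h3]
  linarith

/-- A weighted sum of centred square-integrable variables converges if the weights are `1 / n`. -/
lemma ae_tendsto_sum_div_of_condExp_eq_zero {d : ℕ → Ω → ℝ} {C : ℝ}
    (hadp : ∀ n, StronglyMeasurable[ℱ (n + 1)] (d n)) (hL : ∀ n, MemLp (d n) 2 P)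
    (hC : ∀ n, ∫ ω, d n ω ^ 2 ∂P ≤ C) (h0 : ∀ n, P[d n|ℱ n] =ᵐ[P] 0) :
    ∀ᵐ ω ∂P, ∃ L, Tendsto (fun n => ∑ i ∈ Finset.range n, d i ω / ((i : ℝ) + 1)) atTop (𝓝 L) := by
  set S : ℕ → Ω → ℝ := fun n ω => ∑ i ∈ Finset.range n, d i ω / ((i : ℝ) + 1) with hS
  have hSs : ∀ n, S (n + 1) = fun ω => S n ω + d n ω / ((n : ℝ) + 1) := fun n => by
    funext ω; exact Finset.sum_range_succ _ _
  have hSm : ∀ n, StronglyMeasurable[ℱ n] (S n) := fun n => by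
    refine Finset.stronglyMeasurable_fun_sum _ fun i hi => ?_
    have hin : i + 1 ≤ n := Finset.mem_range.1 hi
    exact ((hadp i).mono (ℱ.mono hin)).div stronglyMeasurable_const
  have hSL : ∀ n, MemLp (S n) 2 P := fun n => by
    refine memLp_finsetSum _ fun i _ => ?_
    simpa only [div_eq_mul_inv, mul_comm] using (hL i).const_mul ((i : ℝ) + 1)⁻¹
  have hSi : ∀ n, Integrable (S n) P := fun n => (hSL n).integrable one_le_two
  have hdi : ∀ n, Integrable (d n) P := fun n => (hL n).integrable one_le_two
  have hC0 : 0 ≤ C := (integral_nonneg fun ω => sq_nonneg _).trans (hC 0)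
  have hmart : Martingale S ℱ P := by
    refine martingale_of_condExp_sub_eq_zero_nat hSm hSi fun n => ?_
    have e : S (n + 1) - S n = ((n : ℝ) + 1)⁻¹ • d n := by
      funext ω
      rw [hSs]
      simp [div_eq_inv_mul]
    rw [e]
    refine (condExp_smul _ _ _).trans ?_
    filter_upwards [h0 n] with ω hω
    simp [hω]
  have horth : ∀ n, ∫ ω, S n ω * d n ω ∂P = 0 := fun n => by
    rw [← integral_condExp (ℱ.le n)]
    have h1 : Integrable (S n * d n) P := (hSL n).integrable_mul (hL n)
    refine integral_eq_zero_of_ae ?_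
    filter_upwards [condExp_mul_of_stronglyMeasurable_left (hSm n) h1 (hdi n), h0 n] with ω h2 h3
    have : (P[fun ω => S n ω * d n ω|ℱ n]) ω = (P[S n * d n|ℱ n]) ω := rfl
    rw [this, h2, Pi.mul_apply, h3]
    simp
  -- Orthogonal increments: the cross term vanishes and step n adds at most C/(n+1)², which is
  -- summable.
  have hsq : ∀ n : ℕ, ∫ ω, S n ω ^ 2 ∂P ≤ C * ∑ i ∈ Finset.range n, 1 / ((i : ℝ) + 1) ^ 2 := by
    intro n
    induction n with
    | zero => simp [hS]
    | succ n ih =>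
      have e : ∫ ω, S (n + 1) ω ^ 2 ∂P = ∫ ω, S n ω ^ 2 ∂P +
          2 / ((n : ℝ) + 1) * ∫ ω, S n ω * d n ω ∂P +
          1 / ((n : ℝ) + 1) ^ 2 * ∫ ω, d n ω ^ 2 ∂P := by
        have i1 : Integrable (fun ω => S n ω * d n ω) P := (hSL n).integrable_mul (hL n)
        have i2 : Integrable (fun ω => S n ω ^ 2 + 2 / ((n : ℝ) + 1) * (S n ω * d n ω)) P :=
          (hSL n).integrable_sq.add (i1.const_mul _)
        rw [← integral_const_mul, ← integral_const_mul, ← integral_add (hSL n).integrable_sq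
          (i1.const_mul _), ← integral_add i2 ((hL n).integrable_sq.const_mul _)]
        refine integral_congr_ae (Eventually.of_forall fun ω => ?_)
        simp only [hSs]
        field_simp
        ring
      rw [e, horth, Finset.sum_range_succ, mul_add, mul_zero, add_zero]
      refine add_le_add ih ?_
      rw [mul_comm]
      exact mul_le_mul_of_nonneg_right (hC n) (by positivity)
  have hsum : Summable (fun i : ℕ => 1 / ((i : ℝ) + 1) ^ 2) := by
    have := (summable_nat_add_iff 1).2 (Real.summable_one_div_nat_pow.2 one_lt_two)
    simpa using this
  set B := C * ∑' i : ℕ, 1 / ((i : ℝ) + 1) ^ 2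
  have hB : ∀ n, ∫ ω, S n ω ^ 2 ∂P ≤ B := fun n => (hsq n).trans
    (mul_le_mul_of_nonneg_left (hsum.sum_le_tsum _ fun i _ => by positivity) hC0)
  -- Martingale convergence needs an L¹ bound; |x| ≤ 1 + x² supplies it from the L² bound.
  refine hmart.submartingale.exists_ae_tendsto_of_bdd (R := (1 + B).toNNReal) fun n => ?_
  rw [eLpNorm_one_eq_lintegral_enorm, ← ofReal_integral_norm_eq_lintegral_enorm (hSi n)]
  refine ENNReal.ofReal_le_ofReal ?_
  calc ∫ ω, ‖S n ω‖ ∂P ≤ ∫ ω, (1 + S n ω ^ 2) ∂P := by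
        refine integral_mono (hSi n).norm ((integrable_const _).add (hSL n).integrable_sq)
          fun ω => ?_
        rw [Real.norm_eq_abs, ← sq_abs]
        nlinarith [sq_nonneg (|S n ω| - 1), abs_nonneg (S n ω)]
    _ = 1 + ∫ ω, S n ω ^ 2 ∂P := by
        rw [integral_add (integrable_const _) (hSL n).integrable_sq]; simp
    _ ≤ 1 + B := by linarith [hB n]

/-- The law of large numbers for adapted sequences with bounded second moments, centred by their
conditional expectations. -/
theorem ae_tendsto_average_sub_condExp {ξ : ℕ → Ω → ℝ} {C : ℝ}
    (hadp : ∀ n, StronglyMeasurable[ℱ (n + 1)] (ξ n)) (hL : ∀ n, MemLp (ξ n) 2 P)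
    (hC : ∀ n, ∫ ω, ξ n ω ^ 2 ∂P ≤ C) :
    ∀ᵐ ω ∂P, Tendsto (fun n : ℕ =>
      (n : ℝ)⁻¹ * ∑ i ∈ Finset.range n, (ξ i ω - (P[ξ i|ℱ i]) ω)) atTop (𝓝 0) := by
  have h := ae_tendsto_sum_div_of_condExp_eq_zero (P := P) (ℱ := ℱ) (C := C)
    (d := fun n => ξ n - P[ξ n|ℱ n])
    (fun n => (hadp n).sub (stronglyMeasurable_condExp.mono (ℱ.mono n.le_succ)))
    (fun n => (hL n).sub ((hL n).condExp one_le_two))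
    (fun n => (integral_sq_sub_condExp_le (ℱ.le n) (hL n)).trans (hC n)) (fun n => ?_)
  · filter_upwards [h] with ω ⟨L, hω⟩
    exact tendsto_average_of_tendsto_sum_div hω
  · filter_upwards [condExp_sub ((hL n).integrable one_le_two) integrable_condExp (ℱ n)]
      with ω hω
    rw [hω, Pi.sub_apply, condExp_of_stronglyMeasurable (ℱ.le n) stronglyMeasurable_condExp
      integrable_condExp]
    simp

end LawOfLargeNumbers

/-! ### Degrees and edge numbers for a set of types -/

lemma Multiset.card_eq_sum_count_sym2 {v : ℕ} {W : Finset ℕ} {M : Multiset (Sym2 ℕ)}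
    (h : ∀ e ∈ M, ∃ w ∈ W, e = s(v, w)) : M.card = ∑ w ∈ W, M.count s(v, w) := by
  induction M using Multiset.induction with
  | empty => simp
  | cons e M ih =>
    obtain ⟨w, hw, rfl⟩ := h e (Multiset.mem_cons_self _ _)
    rw [Multiset.card_cons, ih fun e he => h e (Multiset.mem_cons_of_mem he)]
    simp only [Multiset.count_cons, Finset.sum_add_distrib, Nat.add_left_cancel_iff]
    rw [Finset.sum_eq_single w]
    · simp
    · intro b _ hb
      rw [if_neg]
      intro h
      rw [Sym2.congr_right] at h
      exact hb h
    · exact fun h => absurd hw h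

/-- The handshake lemma: without loops every edge has exactly two ends. -/
lemma Multiset.sum_countP_mem_sym2 {V : Finset ℕ} {M : Multiset (Sym2 ℕ)}
    (hd : ∀ e ∈ M, ¬ e.IsDiag) (hV : ∀ e ∈ M, ∀ v ∈ e, v ∈ V) :
    ∑ w ∈ V, M.countP (fun e => w ∈ e) = 2 * M.card := by
  induction M using Multiset.induction with
  | empty => simp
  | cons e M ih =>
    have ih' := ih (fun e he => hd e (Multiset.mem_cons_of_mem he))
      (fun e he => hV e (Multiset.mem_cons_of_mem he))
    have h1 := hd e (Multiset.mem_cons_self _ _)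
    have h2 := hV e (Multiset.mem_cons_self _ _)
    simp only [Multiset.countP_cons, Finset.sum_add_distrib, ih', Multiset.card_cons]
    have : ∑ w ∈ V, (if w ∈ e then 1 else 0) = 2 := by
      induction e with
      | _ x y =>
        rw [Sym2.mk_isDiag_iff] at h1
        have hx := h2 x (Sym2.mem_mk_left x y)
        have hy := h2 y (Sym2.mem_mk_right x y)
        rw [← Finset.card_filter]
        have : V.filter (fun w => w ∈ s(x, y)) = {x, y} := by
          ext w
          simp only [Finset.mem_filter, Sym2.mem_iff, Finset.mem_insert, Finset.mem_singleton]
          constructor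
          · exact fun h => h.2
          · rintro (rfl | rfl) <;> simp [*]
        rw [this, Finset.card_pair h1]
    rw [this]
    ring

namespace TypedGraph

variable {N : ℕ}

/-- The number of edges with type in `S` connected to `v`. -/
def degIn (G : TypedGraph N) (S : Finset (Fin N)) (v : ℕ) : ℕ := ∑ k ∈ S, G.deg k v

/-- The number of edges with type in `S`. -/
def edgesIn (G : TypedGraph N) (S : Finset (Fin N)) : ℕ := ∑ k ∈ S, G.edgeCount k

/-- The number of edges with type in `S` between `v` and `w`. -/
def multIn (G : TypedGraph N) (S : Finset (Fin N)) (v w : ℕ) : ℕ := ∑ k ∈ S, G.mult k v w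

/-- The number of vertices with exactly `l` edges with type in `S` connected to them. -/
def numDegIn (G : TypedGraph N) (S : Finset (Fin N)) (l : ℕ) : ℕ :=
  (G.verts.filter (fun v => G.degIn S v = l)).card

lemma edgesIn_univ (G : TypedGraph N) : G.edgesIn Finset.univ = G.totalEdges := rfl

lemma edgesIn_le_totalEdges (G : TypedGraph N) (S : Finset (Fin N)) :
    G.edgesIn S ≤ G.totalEdges :=
  Finset.sum_le_sum_of_subset (Finset.subset_univ S)

lemma sum_degIn (G : TypedGraph N) (S : Finset (Fin N)) :
    ∑ w ∈ G.verts, G.degIn S w = 2 * G.edgesIn S := by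
  simp only [degIn, edgesIn, edgeCount]
  rw [Finset.sum_comm, Finset.mul_sum]
  exact Finset.sum_congr rfl fun k _ => Multiset.sum_countP_mem_sym2 (G.loopless k) (G.incident k)

namespace IsExtension

variable {G H : TypedGraph N} {v : ℕ}

lemma edges_eq_add (h : G.IsExtension H v) (k : Fin N) :
    H.edges k = G.edges k + (H.edges k - G.edges k) :=
  (add_tsub_cancel_of_le (h.edges_le k)).symm

/-- No old edge touches the new vertex, so subtracting the old edges leaves the count unchanged. -/
lemma mult_eq (_h : G.IsExtension H v) (hv : v ∉ G.verts) (k : Fin N) (w : ℕ) :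
    H.mult k v w = (H.edges k - G.edges k).count s(v, w) := by
  have h0 : (G.edges k).count s(v, w) = 0 :=
    Multiset.count_eq_zero.2 fun he => hv (G.incident k _ he v (Sym2.mem_mk_left v w))
  rw [mult, Multiset.count_sub, h0, Nat.sub_zero]

lemma exists_eq_of_mem (h : G.IsExtension H v) (k : Fin N) :
    ∀ e ∈ H.edges k - G.edges k, ∃ w ∈ G.verts, e = s(v, w) := by
  intro e he
  have heH : e ∈ H.edges k := Multiset.mem_of_le tsub_le_self he
  obtain ⟨w, rfl⟩ := h.new_edges k e he
  refine ⟨w, ?_, rfl⟩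
  have hw := H.incident k _ heH w (Sym2.mem_mk_right v w)
  rw [h.verts_eq, Finset.mem_insert] at hw
  refine hw.resolve_left fun hwv => H.loopless k _ heH ?_
  rw [Sym2.mk_isDiag_iff, hwv]

lemma edgeCount_eq (h : G.IsExtension H v) (hv : v ∉ G.verts) (k : Fin N) :
    H.edgeCount k = G.edgeCount k + ∑ w ∈ G.verts, H.mult k v w := by
  simp only [h.mult_eq hv]
  rw [← Multiset.card_eq_sum_count_sym2 (h.exists_eq_of_mem k), edgeCount, h.edges_eq_add k,
    Multiset.card_add]
  simp [edgeCount]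

lemma deg_eq (h : G.IsExtension H v) (hv : v ∉ G.verts) (k : Fin N) {w : ℕ} (hw : w ∈ G.verts) :
    H.deg k w = G.deg k w + H.mult k v w := by
  have hwv : w ≠ v := fun e => hv (e ▸ hw)
  rw [h.mult_eq hv, deg, h.edges_eq_add k, Multiset.countP_add, add_tsub_cancel_left, deg,
    Multiset.count]
  congr 1
  refine Multiset.countP_congr rfl fun e he => ?_
  obtain ⟨u, hu, rfl⟩ := h.exists_eq_of_mem k e he
  simp only [Sym2.mem_iff, hwv, false_or, Sym2.congr_right]

lemma deg_new (h : G.IsExtension H v) (hv : v ∉ G.verts) (k : Fin N) :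
    H.deg k v = ∑ w ∈ G.verts, H.mult k v w := by
  simp only [h.mult_eq hv]
  have h0 : (G.edges k).countP (fun e => v ∈ e) = 0 :=
    Multiset.countP_eq_zero.2 fun e he hve => hv (G.incident k e he v hve)
  rw [← Multiset.card_eq_sum_count_sym2 (h.exists_eq_of_mem k), deg, h.edges_eq_add k,
    Multiset.countP_add, h0, zero_add, add_tsub_cancel_left, Multiset.countP_eq_card]
  exact h.new_edges k

lemma edgesIn_eq (h : G.IsExtension H v) (hv : v ∉ G.verts) (S : Finset (Fin N)) :
    H.edgesIn S = G.edgesIn S + ∑ w ∈ G.verts, H.multIn S v w := by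
  simp only [edgesIn, multIn, h.edgeCount_eq hv, Finset.sum_add_distrib]
  rw [Finset.sum_comm]

lemma degIn_eq (h : G.IsExtension H v) (hv : v ∉ G.verts) (S : Finset (Fin N)) {w : ℕ}
    (hw : w ∈ G.verts) : H.degIn S w = G.degIn S w + H.multIn S v w := by
  simp only [degIn, multIn, h.deg_eq hv _ hw, Finset.sum_add_distrib]

lemma degIn_new (h : G.IsExtension H v) (hv : v ∉ G.verts) (S : Finset (Fin N)) :
    H.degIn S v = ∑ w ∈ G.verts, H.multIn S v w := by
  simp only [degIn, multIn, h.deg_new hv]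
  rw [Finset.sum_comm]

end IsExtension

end TypedGraph

/-! ### Sums of independent Poisson variables -/

/-- Merges the independent Poisson counts over types and old vertices into one count, which carries
the summed rate. -/
lemma map_sum_pi_poissonMeasure {ι : Type*} [Fintype ι] (ρ : ι → NNReal) (I : Finset ι) :
    (Measure.pi fun i => poissonMeasure (ρ i)).map (fun x => ∑ i ∈ I, x i) =
      poissonMeasure (∑ i ∈ I, ρ i) := by
  classical
  set κ := Measure.pi fun i => poissonMeasure (ρ i) with hκ
  have hind : iIndepFun (fun (i : ι) (x : ι → ℕ) => x i) κ :=
    iIndepFun_pi (X := fun _ (m : ℕ) => m) fun i => aemeasurable_id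
  have hlaw : ∀ i, κ.map (fun x : ι → ℕ => x i) = poissonMeasure (ρ i) := fun i =>
    (measurePreserving_eval (fun i => poissonMeasure (ρ i)) i).map_eq
  induction I using Finset.induction_on with
  | empty =>
    simp only [Finset.sum_empty]
    rw [Measure.map_const, measure_univ, one_smul]
    -- The empty sum has the Dirac law at 0, which is the Poisson law of rate 0.
    refine Measure.ext_of_singleton fun n => ?_
    rw [poissonMeasure_singleton]
    rcases Nat.eq_zero_or_pos n with rfl | hn
    · simp
    · simp [hn.ne', hn.ne]
  | insert i I hi ih =>
    have h := hind.indepFun_finsetSum_of_notMem (fun i => measurable_pi_apply i) hi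
    have h1 : HasLaw (∑ j ∈ I, fun x : ι → ℕ => x j) (poissonMeasure (∑ i ∈ I, ρ i)) κ := by
      refine ⟨Measurable.of_discrete.aemeasurable, ?_⟩
      rw [← ih]
      congr 1
      funext x
      simp
    have h2 : HasLaw (fun x : ι → ℕ => x i) (poissonMeasure (ρ i)) κ :=
      ⟨(measurable_pi_apply i).aemeasurable, hlaw i⟩
    have h3 := (h.hasLaw_add_poissonMeasure h1 h2).map_eq
    rw [Finset.sum_insert hi, add_comm, ← h3]
    congr 1
    funext x
    simp [Finset.sum_insert hi, add_comm]

/-! ### Conditioning -/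

section Conditioning

variable {Ω : Type*} {m mΩ : MeasurableSpace Ω} {P : Measure Ω} [IsProbabilityMeasure P]

/-- The freezing lemma: even under `P` restricted to a set of `m`, the pair (X, Z) has a product
law, so X is integrated out with Z held fixed. -/
lemma setLIntegral_of_indep (hm : m ≤ mΩ) {X Z : Ω → ℝ}
    (hX : Measurable X) (hZ : Measurable[m] Z)
    (hind : Indep (MeasurableSpace.comap X inferInstance) m P) {h : ℝ → ℝ → ENNReal}
    (hh : Measurable (Function.uncurry h)) {A : Set Ω} (hA : MeasurableSet[m] A) :
    ∫⁻ ω in A, h (X ω) (Z ω) ∂P = ∫⁻ ω in A, ∫⁻ x, h x (Z ω) ∂(P.map X) ∂P := by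
  have hZ' : Measurable Z := hZ.mono hm le_rfl
  have hpr : (P.map X).prod ((P.restrict A).map Z) =
      (P.restrict A).map (fun ω => (X ω, Z ω)) := by
    refine Measure.prod_eq fun B C hB hC => ?_
    rw [Measure.map_apply (hX.prodMk hZ') (hB.prod hC), Measure.map_apply hX hB,
      Measure.map_apply hZ' hC,
      Measure.restrict_apply ((hX.prodMk hZ') (hB.prod hC)), Measure.restrict_apply (hZ' hC)]
    have e : (fun ω => (X ω, Z ω)) ⁻¹' B ×ˢ C ∩ A = X ⁻¹' B ∩ (Z ⁻¹' C ∩ A) := by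
      ext ω
      simp [and_assoc]
    rw [e]
    exact (Indep_iff _ _ _).1 hind _ _ ⟨B, hB, rfl⟩ (MeasurableSet.inter (hZ hC) hA)
  have hp : IsProbabilityMeasure (P.map X) := Measure.isProbabilityMeasure_map hX.aemeasurable
  have h1 : ∫⁻ ω in A, h (X ω) (Z ω) ∂P =
      ∫⁻ y, Function.uncurry h y ∂((P.restrict A).map (fun ω => (X ω, Z ω))) := by
    rw [lintegral_map hh (hX.prodMk hZ')]
    rfl
  rw [h1, ← hpr, lintegral_prod_symm _ hh.aemeasurable, lintegral_map _ hZ']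
  · rfl
  · exact hh.lintegral_prod_left'

/-- Nonnegativity lets Lebesgue integrals be compared first; integrability of X is then inherited
from Y instead of being assumed. -/
lemma condExp_eq_of_setLIntegral_eq (hm : m ≤ mΩ) {X Y : Ω → ℝ}
    (hX0 : ∀ ω, 0 ≤ X ω) (hY0 : ∀ ω, 0 ≤ Y ω) (hX : Measurable X) (hY : Measurable[m] Y)
    (hYi : Integrable Y P) (h : ∀ A, MeasurableSet[m] A →
      ∫⁻ ω in A, ENNReal.ofReal (X ω) ∂P = ∫⁻ ω in A, ENNReal.ofReal (Y ω) ∂P) :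
    Integrable X P ∧ P[X|m] =ᵐ[P] Y ∧ ∫ ω, X ω ∂P = ∫ ω, Y ω ∂P := by
  have hset : ∀ A, MeasurableSet[m] A → ∫ ω in A, X ω ∂P = ∫ ω in A, Y ω ∂P := fun A hA => by
    rw [integral_eq_lintegral_of_nonneg_ae (Eventually.of_forall hX0) hX.aestronglyMeasurable,
      integral_eq_lintegral_of_nonneg_ae (Eventually.of_forall hY0)
        (hY.mono hm le_rfl).aestronglyMeasurable, h A hA]
  have hXi : Integrable X P := by
    refine ⟨hX.aestronglyMeasurable, ?_⟩
    rw [hasFiniteIntegral_iff_ofReal (Eventually.of_forall hX0), ← setLIntegral_univ,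
      h _ MeasurableSet.univ, setLIntegral_univ]
    exact (hasFiniteIntegral_iff_ofReal (Eventually.of_forall hY0)).1 hYi.2
  refine ⟨hXi, ?_, ?_⟩
  · exact (ae_eq_condExp_of_forall_setIntegral_eq hm hXi (fun A _ _ => hYi.integrableOn)
      (fun A hA _ => (hset A hA).symm) hY.stronglyMeasurable.aestronglyMeasurable).symm
  · simpa using hset _ MeasurableSet.univ

end Conditioning

lemma ofReal_pois (m : ℕ) (x : ℝ) :
    ENNReal.ofReal (pois m x) = poissonMeasure x.toNNReal {m} := by
  rw [pois, ofReal_measureReal]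

lemma measurable_lintegral_poissonMeasure {α : Type*} [MeasurableSpace α] {g : α → ℝ}
    (hg : Measurable g) (f : ℕ → ENNReal) :
    Measurable fun a => ∫⁻ m, f m ∂poissonMeasure (g a).toNNReal := by
  have e : (fun a => ∫⁻ m, f m ∂poissonMeasure (g a).toNNReal) =
      fun a => ∑' m, f m * ENNReal.ofReal (pois m (g a)) := by
    funext a
    rw [lintegral_countable']
    simp only [ofReal_pois]
  rw [e]
  exact Measurable.tsum fun m =>
    (((continuous_pois m).measurable.comp hg).ennreal_ofReal).const_mul _

/-! ### The model -/

namespace IsIndependentEdgesModel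

open TypedGraph

variable {Ω : Type*} {mΩ : MeasurableSpace Ω} {P : Measure Ω} {N : ℕ} {s : ℕ}
  {G₀ : TypedGraph N} {lam : ℕ → Ω → ℝ} {G : ℕ → Ω → TypedGraph N}

lemma verts_eq (h : IsIndependentEdgesModel P s G₀ lam G) (n : ℕ) (ω : Ω) :
    (G n ω).verts = Finset.range (s + n) := by
  induction n with
  | zero => rw [h.start, h.initial_verts, add_zero]
  | succ n ih => rw [(h.step n ω).verts_eq, ih, ← add_assoc, Finset.range_add_one]

lemma notMem_verts (h : IsIndependentEdgesModel P s G₀ lam G) (n : ℕ) (ω : Ω) :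
    s + n ∉ (G n ω).verts := by
  rw [h.verts_eq]
  exact Finset.notMem_range_self

lemma graphHistory_le (h : IsIndependentEdgesModel P s G₀ lam G) (n : ℕ) :
    graphHistory G n ≤ mΩ :=
  iSup₂_le fun m _ => (h.measurable_graph m).comap_le

lemma graphHistoryPlus_le (h : IsIndependentEdgesModel P s G₀ lam G) (n : ℕ) :
    graphHistoryPlus G lam n ≤ mΩ :=
  sup_le (h.graphHistory_le n) (h.measurable_lam (n + 1)).comap_le

/-- The filtration generated by the graphs. -/
def filtration (h : IsIndependentEdgesModel P s G₀ lam G) : Filtration ℕ mΩ where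
  seq := graphHistory G
  mono' _ _ hij := biSup_mono fun _ hm => le_trans hm hij
  le' := h.graphHistory_le

lemma measurable_history (G : ℕ → Ω → TypedGraph N) (n : ℕ) : Measurable[graphHistory G n] (G n) :=
  measurable_iff_comap_le.2 (le_iSup₂_of_le (f := fun m (_ : m ∈ Set.Iic n) =>
    MeasurableSpace.comap (G m) inferInstance) n (Set.mem_Iic.2 le_rfl) le_rfl)

lemma measurable_comp_history {β : Type*} [MeasurableSpace β] (G : ℕ → Ω → TypedGraph N) (n : ℕ)
    (g : TypedGraph N → β) : Measurable[graphHistory G n] (fun ω => g (G n ω)) :=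
  (measurable_from_top (f := g)).comp (measurable_history G n)

lemma measurable_comp (h : IsIndependentEdgesModel P s G₀ lam G) {β : Type*} [MeasurableSpace β]
    (n : ℕ) (g : TypedGraph N → β) : Measurable (fun ω => g (G n ω)) :=
  (measurable_from_top (f := g)).comp (h.measurable_graph n)

variable [IsProbabilityMeasure P]

/-- The joint conditional distribution of the numbers of new edges. -/
lemma setLIntegral_comp_mult (h : IsIndependentEdgesModel P s G₀ lam G) (n : ℕ)
    (f : (Fin N × Fin (s + n) → ℕ) → ENNReal) {A : Set Ω}
    (hA : MeasurableSet[graphHistoryPlus G lam n] A) :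
    ∫⁻ ω in A, f (fun i => (G (n + 1) ω).mult i.1 (s + n) i.2) ∂P =
      ∫⁻ ω in A, ∫⁻ x, f x ∂(Measure.pi fun i : Fin N × Fin (s + n) => poissonMeasure
        (lam (n + 1) ω * ((G n ω).deg i.1 i.2 : ℝ) /
          (2 * ((G n ω).totalEdges : ℝ))).toNNReal) ∂P := by
  set Δ : Ω → Fin N × Fin (s + n) → ℕ := fun ω i => (G (n + 1) ω).mult i.1 (s + n) i.2 with hΔ
  set κ : Ω → Measure (Fin N × Fin (s + n) → ℕ) := fun ω =>
    Measure.pi fun i : Fin N × Fin (s + n) => poissonMeasure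
        (lam (n + 1) ω * ((G n ω).deg i.1 i.2 : ℝ) /
          (2 * ((G n ω).totalEdges : ℝ))).toNNReal with hκ
  have hΔm : Measurable Δ := h.measurable_comp (n + 1)
    (fun H (i : Fin N × Fin (s + n)) => H.mult i.1 (s + n) i.2)
  have hκ1 : ∀ (δ : Fin N × Fin (s + n) → ℕ) ω, κ ω {δ} = ENNReal.ofReal
      (∏ i : Fin N × Fin (s + n), pois (δ i)
        (lam (n + 1) ω * ((G n ω).deg i.1 i.2 : ℝ) / (2 * ((G n ω).totalEdges : ℝ)))) := by
    intro δ ω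
    rw [hκ, Measure.pi_singleton, ENNReal.ofReal_prod_of_nonneg fun i _ => pois_nonneg _ _]
    simp only [ofReal_pois]
  have hpm : ∀ δ : Fin N × Fin (s + n) → ℕ, Measurable fun ω =>
      ∏ i : Fin N × Fin (s + n), pois (δ i)
        (lam (n + 1) ω * ((G n ω).deg i.1 i.2 : ℝ) / (2 * ((G n ω).totalEdges : ℝ))) := by
    intro δ
    refine Finset.measurable_fun_prod _ fun i _ => (continuous_pois _).measurable.comp ?_
    exact ((h.measurable_lam _).mul (h.measurable_comp n fun H => (H.deg i.1 i.2 : ℝ))).div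
      (h.measurable_comp n fun H => (2 * (H.totalEdges : ℝ)))
  have hsingle : ∀ δ : Fin N × Fin (s + n) → ℕ,
      P.restrict A (Δ ⁻¹' {δ}) = ∫⁻ ω in A, κ ω {δ} ∂P := by
    intro δ
    -- Only labels below s + n matter; the default 0 merely extends δ to all labels.
    have hp := h.poisson n
      (fun k w => if hw : w < s + n then δ (k, ⟨w, hw⟩) else 0)
    set B := {ω | ∀ k, ∀ w ∈ Finset.range (s + n), (G (n + 1) ω).mult k (s + n) w =
      if hw : w < s + n then δ (k, ⟨w, hw⟩) else 0} with hB
    have hBΔ : Δ ⁻¹' {δ} = B := by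
      ext ω
      simp only [Set.mem_preimage, Set.mem_singleton_iff, hB, Set.mem_ofPred_eq, hΔ]
      constructor
      · rintro rfl k w hw
        rw [dif_pos (Finset.mem_range.1 hw)]
      · intro hω
        funext ⟨k, w⟩
        have := hω k w (Finset.mem_range.2 w.2)
        rw [dif_pos w.2] at this
        exact this
    have hBm : MeasurableSet B := by
      rw [← hBΔ]
      exact hΔm (measurableSet_singleton δ)
    have hA' : MeasurableSet A := h.graphHistoryPlus_le n _ hA
    have h1 : ∫ ω in A, B.indicator (fun _ => (1 : ℝ)) ω ∂P = ∫ ω in A,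
        ∏ i : Fin N × Fin (s + n), pois (δ i)
        (lam (n + 1) ω * ((G n ω).deg i.1 i.2 : ℝ) / (2 * ((G n ω).totalEdges : ℝ))) ∂P := by
      rw [← setIntegral_condExp (h.graphHistoryPlus_le n)
        ((integrable_const (1 : ℝ)).indicator hBm) hA]
      refine setIntegral_congr_ae hA' (hp.mono fun ω hω _ => ?_)
      rw [hω, Fintype.prod_prod_type]
      refine Finset.prod_congr rfl fun k _ => ?_
      rw [Finset.prod_range]
      refine Finset.prod_congr rfl fun w _ => ?_
      rw [dif_pos w.2]
      rfl
    have h2 : ∫⁻ ω in A, κ ω {δ} ∂P = ENNReal.ofReal (∫ ω in A,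
        ∏ i : Fin N × Fin (s + n), pois (δ i)
        (lam (n + 1) ω * ((G n ω).deg i.1 i.2 : ℝ) / (2 * ((G n ω).totalEdges : ℝ))) ∂P) := by
      simp only [hκ1]
      rw [ofReal_integral_eq_lintegral_ofReal]
      · refine Integrable.of_bound (C := 1) (hpm δ).aestronglyMeasurable
          (Eventually.of_forall fun ω => ?_)
        rw [Real.norm_of_nonneg (Finset.prod_nonneg fun i _ => pois_nonneg _ _)]
        exact Finset.prod_le_one (fun i _ => pois_nonneg _ _) fun i _ => pois_le_one _ _
      · exact Eventually.of_forall fun ω => Finset.prod_nonneg fun i _ => pois_nonneg _ _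
    rw [h2, ← h1, integral_indicator_const _ hBm, hBΔ, smul_eq_mul, mul_one, ofReal_measureReal]
  -- The count vector takes countably many values, so agreement on point masses passes to every `f`.
  have hl : ∫⁻ ω in A, f (Δ ω) ∂P = ∑' δ, f δ * P.restrict A (Δ ⁻¹' {δ}) := by
    rw [← lintegral_map Measurable.of_discrete hΔm, lintegral_countable']
    simp only [Measure.map_apply hΔm (measurableSet_singleton _)]
  have hr : ∫⁻ ω in A, ∫⁻ x, f x ∂(κ ω) ∂P = ∑' δ, ∫⁻ ω in A, f δ * κ ω {δ} ∂P := by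
    rw [← lintegral_tsum]
    · simp only [lintegral_countable']
    · intro δ
      simp only [hκ1]
      exact ((hpm δ).ennreal_ofReal.const_mul _).aemeasurable
  rw [hl, hr]
  refine tsum_congr fun δ => ?_
  rw [hsingle, lintegral_const_mul]
  simp only [hκ1]
  exact (hpm δ).ennreal_ofReal

end IsIndependentEdgesModel

/-! ### Attachment rates and conditional moments of the new edges -/

namespace TypedGraph

variable {N : ℕ}

/-- The normalized number of edge ends with type in `S` at the vertices of `W`. -/
noncomputable def rateIn (G : TypedGraph N) (S : Finset (Fin N)) (W : Finset ℕ) : ℝ :=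
  (∑ w ∈ W, (G.degIn S w : ℝ)) / (2 * (G.totalEdges : ℝ))

lemma rateIn_nonneg (G : TypedGraph N) (S : Finset (Fin N)) (W : Finset ℕ) :
    0 ≤ G.rateIn S W := by
  unfold rateIn; positivity

lemma rateIn_verts (G : TypedGraph N) (S : Finset (Fin N)) :
    G.rateIn S G.verts = (G.edgesIn S : ℝ) / (G.totalEdges : ℝ) := by
  have := G.sum_degIn S
  rw [rateIn, ← Nat.cast_sum, this]
  push_cast
  rw [mul_div_mul_left _ _ two_ne_zero]

lemma rateIn_verts_le_one (G : TypedGraph N) (S : Finset (Fin N)) : G.rateIn S G.verts ≤ 1 := by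
  rw [rateIn_verts]
  exact div_le_one_of_le₀ (by exact_mod_cast G.edgesIn_le_totalEdges S) (Nat.cast_nonneg _)

lemma rateIn_mono (G : TypedGraph N) (S : Finset (Fin N)) {W W' : Finset ℕ} (h : W ⊆ W') :
    G.rateIn S W ≤ G.rateIn S W' := by
  unfold rateIn
  gcongr

end TypedGraph

namespace IsIndependentEdgesModel

open TypedGraph

variable {Ω : Type*} {mΩ : MeasurableSpace Ω} {P : Measure Ω} {N : ℕ} {s : ℕ}
  {G₀ : TypedGraph N} {lam : ℕ → Ω → ℝ} {G : ℕ → Ω → TypedGraph N}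

lemma rateIn_le_one (h : IsIndependentEdgesModel P s G₀ lam G) (n : ℕ) (ω : Ω)
    (S : Finset (Fin N)) {W : Finset ℕ} (hW : W ⊆ Finset.range (s + n)) :
    (G n ω).rateIn S W ≤ 1 := by
  refine ((G n ω).rateIn_mono S hW).trans ?_
  rw [← h.verts_eq n ω]
  exact (G n ω).rateIn_verts_le_one S

lemma sum_product_filter_mem {n : ℕ} {M : Type*} [AddCommMonoid M] (S : Finset (Fin N))
    {W : Finset ℕ} (hW : W ⊆ Finset.range n) (g : Fin N → ℕ → M) :
    ∑ i ∈ S ×ˢ Finset.univ.filter (fun w : Fin n => (w : ℕ) ∈ W), g i.1 i.2 =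
      ∑ w ∈ W, ∑ k ∈ S, g k w := by
  rw [Finset.sum_product, Finset.sum_comm' (t' := Finset.univ.filter fun w : Fin n => (w : ℕ) ∈ W)
    (s' := fun _ => S) (by simp [and_comm]), Finset.sum_filter,
    Fin.sum_univ_eq_sum_range (fun w => if w ∈ W then ∑ k ∈ S, g k w else 0) n,
    ← Finset.sum_filter, Finset.filter_mem_eq_inter, Finset.inter_eq_right.2 hW]

variable [IsProbabilityMeasure P]

/-- The conditional distribution of the number of new edges with type in `S` to `W` is mixed
Poisson. -/
theorem setLIntegral_comp_sum_multIn (h : IsIndependentEdgesModel P s G₀ lam G) (n : ℕ)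
    (S : Finset (Fin N)) {W : Finset ℕ} (hW : W ⊆ Finset.range (s + n)) (f : ℕ → ENNReal)
    {A : Set Ω} (hA : MeasurableSet[graphHistory G n] A) :
    ∫⁻ ω in A, f (∑ w ∈ W, (G (n + 1) ω).multIn S (s + n) w) ∂P =
      ∫⁻ ω in A, mixedPoisMean (P.map (lam (n + 1))) f ((G n ω).rateIn S W) ∂P := by
  set I : Finset (Fin N × Fin (s + n)) :=
    S ×ˢ Finset.univ.filter (fun w : Fin (s + n) => (w : ℕ) ∈ W) with hI
  have h1 := h.setLIntegral_comp_mult n (fun x => f (∑ i ∈ I, x i)) (A := A)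
    (le_sup_left (a := graphHistory G n) _ hA)
  have e1 : ∀ ω, ∑ i ∈ I, (G (n + 1) ω).mult i.1 (s + n) i.2 =
      ∑ w ∈ W, (G (n + 1) ω).multIn S (s + n) w := fun ω =>
    sum_product_filter_mem S hW fun k w => (G (n + 1) ω).mult k (s + n) w
  simp only [e1] at h1
  rw [h1]
  -- The rate is determined by the history, from which `lam (n + 1)` is independent: freeze the rate
  -- and average over the parameter.
  have h2 : ∫⁻ ω in A, ∫⁻ m, f m ∂poissonMeasure
      (lam (n + 1) ω * (G n ω).rateIn S W).toNNReal ∂P =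
      ∫⁻ ω in A, mixedPoisMean (P.map (lam (n + 1))) f ((G n ω).rateIn S W) ∂P :=
    setLIntegral_of_indep (h.graphHistory_le n) (h.measurable_lam (n + 1))
      (measurable_comp_history G n fun H => H.rateIn S W) (h.lam_indep_history n)
      (h := fun x r => ∫⁻ m, f m ∂poissonMeasure (x * r).toNNReal)
      (measurable_lintegral_poissonMeasure (measurable_fst.mul measurable_snd) f) hA
  rw [← h2]
  -- A positive parameter makes every rate nonnegative, so truncation commutes with the sum of the
  -- rates.
  refine setLIntegral_congr_fun_ae (h.graphHistory_le n _ hA) ((h.lam_pos n).mono fun ω hω _ => ?_)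
  have h3 := map_sum_pi_poissonMeasure (fun i : Fin N × Fin (s + n) =>
    (lam (n + 1) ω * ((G n ω).deg i.1 i.2 : ℝ) / (2 * ((G n ω).totalEdges : ℝ))).toNNReal) I
  have h4 : ∑ i ∈ I, (lam (n + 1) ω * ((G n ω).deg i.1 i.2 : ℝ) /
      (2 * ((G n ω).totalEdges : ℝ))).toNNReal =
      (lam (n + 1) ω * (G n ω).rateIn S W).toNNReal := by
    rw [← Real.toNNReal_sum_of_nonneg fun i _ => by positivity,
      sum_product_filter_mem S hW fun k w => lam (n + 1) ω * ((G n ω).deg k w : ℝ) /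
      (2 * ((G n ω).totalEdges : ℝ)), rateIn]
    simp only [degIn, Nat.cast_sum, ← Finset.sum_div, ← Finset.mul_sum]
    rw [mul_div_assoc]
  rw [← h4, ← h3, lintegral_map Measurable.of_discrete Measurable.of_discrete]

section Moments

variable {ν : Measure ℝ} [IsProbabilityMeasure ν]

lemma condExp_indicator_sum_multIn (h : IsIndependentEdgesModel P s G₀ lam G)
    (hν : ∀ n, P.map (lam (n + 1)) = ν) (hpos : ∀ᵐ x ∂ν, 0 < x) (n : ℕ)
    (S : Finset (Fin N)) {W : Finset ℕ} (hW : W ⊆ Finset.range (s + n)) (m : ℕ) :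
    P[fun ω => if ∑ w ∈ W, (G (n + 1) ω).multIn S (s + n) w = m then (1 : ℝ) else 0|
      graphHistory G n] =ᵐ[P] fun ω => mixedPois ν m ((G n ω).rateIn S W) := by
  refine (condExp_eq_of_setLIntegral_eq (h.graphHistory_le n)
    (fun ω => by split_ifs <;> simp) (fun ω => mixedPois_nonneg _ _)
    (h.measurable_comp (n + 1) fun H => if ∑ w ∈ W, H.multIn S (s + n) w = m then (1 : ℝ) else 0)
    (measurable_comp_history G n fun H => mixedPois ν m (H.rateIn S W)) ?_ fun A hA => ?_).2.1
  · refine Integrable.of_bound (C := 1)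
      (h.measurable_comp n fun H => mixedPois ν m (H.rateIn S W)).aestronglyMeasurable
      (Eventually.of_forall fun ω => ?_)
    rw [Real.norm_of_nonneg (mixedPois_nonneg _ _)]
    exact mixedPois_le_one _ _
  · rw [h.setLIntegral_comp_sum_multIn n S hW
      (fun j => ENNReal.ofReal (if j = m then 1 else 0)) hA]
    simp only [hν, mixedPoisMean_single hpos m (rateIn_nonneg _ _ _)]

lemma condExp_sum_multIn (h : IsIndependentEdgesModel P s G₀ lam G)
    (hν : ∀ n, P.map (lam (n + 1)) = ν) (hpos : ∀ᵐ x ∂ν, 0 < x)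
    (h1 : Integrable (fun x => x) ν) (n : ℕ)
    (S : Finset (Fin N)) {W : Finset ℕ} (hW : W ⊆ Finset.range (s + n)) :
    Integrable (fun ω => ((∑ w ∈ W, (G (n + 1) ω).multIn S (s + n) w : ℕ) : ℝ)) P ∧
    P[fun ω => ((∑ w ∈ W, (G (n + 1) ω).multIn S (s + n) w : ℕ) : ℝ)|
      graphHistory G n] =ᵐ[P] fun ω => (∫ x, x ∂ν) * (G n ω).rateIn S W := by
  have hμ := (integral_pos_of_ae_pos hpos h1).le
  have := condExp_eq_of_setLIntegral_eq (P := P) (h.graphHistory_le n)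
    (X := fun ω => ((∑ w ∈ W, (G (n + 1) ω).multIn S (s + n) w : ℕ) : ℝ))
    (Y := fun ω => (∫ x, x ∂ν) * (G n ω).rateIn S W)
    (fun ω => Nat.cast_nonneg _) (fun ω => mul_nonneg hμ (rateIn_nonneg _ _ _))
    (h.measurable_comp (n + 1) fun H => ((∑ w ∈ W, H.multIn S (s + n) w : ℕ) : ℝ))
    (measurable_comp_history G n fun H => (∫ x, x ∂ν) * H.rateIn S W) ?_ fun A hA => ?_
  · exact ⟨this.1, this.2.1⟩
  · refine Integrable.of_bound (C := ∫ x, x ∂ν)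
      (h.measurable_comp n fun H => (∫ x, x ∂ν) * H.rateIn S W).aestronglyMeasurable
      (Eventually.of_forall fun ω => ?_)
    rw [Real.norm_of_nonneg (mul_nonneg hμ (rateIn_nonneg _ _ _))]
    exact mul_le_of_le_one_right hμ (h.rateIn_le_one n ω S hW)
  · rw [h.setLIntegral_comp_sum_multIn n S hW (fun j => ENNReal.ofReal j) hA]
    simp only [hν, mixedPoisMean_id hpos h1 (rateIn_nonneg _ _ _)]

/-- Rates are at most 1, hence the bound on the second moment is uniform in n, as the law of large
numbers requires. -/
lemma condExp_sq_sum_multIn (h : IsIndependentEdgesModel P s G₀ lam G)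
    (hν : ∀ n, P.map (lam (n + 1)) = ν) (hpos : ∀ᵐ x ∂ν, 0 < x)
    (h1 : Integrable (fun x => x) ν) (h2 : Integrable (fun x => x ^ 2) ν) (n : ℕ)
    (S : Finset (Fin N)) {W : Finset ℕ} (hW : W ⊆ Finset.range (s + n)) :
    Integrable (fun ω => ((∑ w ∈ W, (G (n + 1) ω).multIn S (s + n) w : ℕ) : ℝ) ^ 2) P ∧
    P[fun ω => ((∑ w ∈ W, (G (n + 1) ω).multIn S (s + n) w : ℕ) : ℝ) ^ 2|
      graphHistory G n] =ᵐ[P] (fun ω => (∫ x, x ∂ν) * (G n ω).rateIn S W +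
        (∫ x, x ^ 2 ∂ν) * (G n ω).rateIn S W ^ 2) ∧
    ∫ ω, ((∑ w ∈ W, (G (n + 1) ω).multIn S (s + n) w : ℕ) : ℝ) ^ 2 ∂P ≤
      (∫ x, x ∂ν) + ∫ x, x ^ 2 ∂ν := by
  have hμ := (integral_pos_of_ae_pos hpos h1).le
  have hμ2 : 0 ≤ ∫ x, x ^ 2 ∂ν := integral_nonneg fun x => sq_nonneg x
  have hY0 : ∀ ω, 0 ≤ (∫ x, x ∂ν) * (G n ω).rateIn S W +
        (∫ x, x ^ 2 ∂ν) * (G n ω).rateIn S W ^ 2 := fun ω =>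
    add_nonneg (mul_nonneg hμ (rateIn_nonneg _ _ _)) (mul_nonneg hμ2 (sq_nonneg _))
  have hY1 : ∀ ω, (∫ x, x ∂ν) * (G n ω).rateIn S W +
        (∫ x, x ^ 2 ∂ν) * (G n ω).rateIn S W ^ 2 ≤ (∫ x, x ∂ν) + ∫ x, x ^ 2 ∂ν := fun ω => by
    have h0 := rateIn_nonneg (G n ω) S W
    have h1 := h.rateIn_le_one n ω S hW
    exact add_le_add (mul_le_of_le_one_right hμ h1)
      (mul_le_of_le_one_right hμ2 (pow_le_one₀ h0 h1))
  have hYi : Integrable (fun ω => (∫ x, x ∂ν) * (G n ω).rateIn S W +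
        (∫ x, x ^ 2 ∂ν) * (G n ω).rateIn S W ^ 2) P := by
    refine Integrable.of_bound (C := (∫ x, x ∂ν) + ∫ x, x ^ 2 ∂ν)
      (h.measurable_comp n fun H => (∫ x, x ∂ν) * H.rateIn S W +
        (∫ x, x ^ 2 ∂ν) * H.rateIn S W ^ 2).aestronglyMeasurable
      (Eventually.of_forall fun ω => ?_)
    rw [Real.norm_of_nonneg (hY0 ω)]
    exact hY1 ω
  have := condExp_eq_of_setLIntegral_eq (P := P) (h.graphHistory_le n)
    (X := fun ω => ((∑ w ∈ W, (G (n + 1) ω).multIn S (s + n) w : ℕ) : ℝ) ^ 2)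
    (fun ω => sq_nonneg _) hY0
    (h.measurable_comp (n + 1) fun H => ((∑ w ∈ W, H.multIn S (s + n) w : ℕ) : ℝ) ^ 2)
    (measurable_comp_history G n fun H => (∫ x, x ∂ν) * H.rateIn S W +
        (∫ x, x ^ 2 ∂ν) * H.rateIn S W ^ 2) hYi fun A hA => ?_
  · refine ⟨this.1, this.2.1, ?_⟩
    rw [this.2.2]
    have := integral_mono hYi (integrable_const _) hY1
    simpa using this
  · rw [h.setLIntegral_comp_sum_multIn n S hW (fun j => ENNReal.ofReal ((j : ℝ) ^ 2)) hA]
    simp only [hν, mixedPoisMean_sq hpos h1 h2 (rateIn_nonneg _ _ _)]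

end Moments

end IsIndependentEdgesModel

/-! ### A calculus of conditional expectations -/

section HasCondExp

variable {Ω : Type*} {m mΩ : MeasurableSpace Ω} {P : Measure Ω} {X X' Y Y' c : Ω → ℝ}

/-- `X` is integrable with conditional expectation `Y`. -/
def HasCondExp (m : MeasurableSpace Ω) {mΩ : MeasurableSpace Ω} (P : Measure Ω)
    (X Y : Ω → ℝ) : Prop :=
  Integrable X P ∧ P[X|m] =ᵐ[P] Y

namespace HasCondExp

lemma add (h : HasCondExp m P X Y) (h' : HasCondExp m P X' Y') :
    HasCondExp m P (fun ω => X ω + X' ω) (fun ω => Y ω + Y' ω) :=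
  ⟨h.1.add h'.1, (condExp_add h.1 h'.1 m).trans (h.2.add h'.2)⟩

lemma sub (h : HasCondExp m P X Y) (h' : HasCondExp m P X' Y') :
    HasCondExp m P (fun ω => X ω - X' ω) (fun ω => Y ω - Y' ω) :=
  ⟨h.1.sub h'.1, (condExp_sub h.1 h'.1 m).trans (h.2.sub h'.2)⟩

lemma sum {ι : Type*} {X Y : ι → Ω → ℝ} {I : Finset ι} (h : ∀ i ∈ I, HasCondExp m P (X i) (Y i)) :
    HasCondExp m P (fun ω => ∑ i ∈ I, X i ω) (fun ω => ∑ i ∈ I, Y i ω) := by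
  classical
  induction I using Finset.induction_on with
  | empty =>
    simp only [Finset.sum_empty]
    refine ⟨integrable_zero _ _ _, ?_⟩
    exact Eventually.of_forall fun ω => congrFun (condExp_zero (μ := P) (m := m) (E := ℝ)) ω
  | insert i I hi ih =>
    simp only [Finset.sum_insert hi]
    exact (h i (Finset.mem_insert_self _ _)).add
      (ih fun j hj => h j (Finset.mem_insert_of_mem hj))

lemma mul_left [IsFiniteMeasure P] (hm : m ≤ mΩ) (h : HasCondExp m P X Y) {C : ℝ}
    (hc : Measurable[m] c) (hC : ∀ ω, |c ω| ≤ C) :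
    HasCondExp m P (fun ω => c ω * X ω) (fun ω => c ω * Y ω) := by
  have hi : Integrable (fun ω => c ω * X ω) P :=
    h.1.bdd_mul (hc.mono hm le_rfl).aestronglyMeasurable (Eventually.of_forall hC)
  refine ⟨hi, ?_⟩
  filter_upwards [condExp_mul_of_stronglyMeasurable_left (m := m) hc.stronglyMeasurable hi h.1,
    h.2] with ω h1 h2
  have : (P[fun ω => c ω * X ω|m]) ω = (P[c * X|m]) ω := rfl
  rw [this, h1, Pi.mul_apply, h2]

lemma of_measurable [IsFiniteMeasure P] (hm : m ≤ mΩ) (hc : Measurable[m] c)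
    (hi : Integrable c P) : HasCondExp m P c c :=
  ⟨hi, by rw [condExp_of_stronglyMeasurable hm hc.stronglyMeasurable hi]⟩

end HasCondExp

end HasCondExp

/-! ### Growth of the edge numbers -/

/-- From log(1+u) ≥ 2u/(u+2) ≥ u - u²/2 at u = t/a. -/
lemma neg_log_add_le {a t : ℝ} (ha : 0 < a) (ht : 0 ≤ t) :
    -Real.log (a + t) ≤ -Real.log a - t / a + t ^ 2 / (2 * a ^ 2) := by
  have e : a + t = a * (1 + t / a) := by field_simp
  have h0 : 0 ≤ t / a := by positivity
  have h1 : t / a - (t / a) ^ 2 / 2 ≤ 2 * (t / a) / (t / a + 2) := by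
    rw [le_div_iff₀ (by positivity)]
    nlinarith [pow_nonneg h0 3]
  have h2 := Real.le_log_one_add_of_nonneg h0
  have h3 : (t / a) ^ 2 / 2 = t ^ 2 / (2 * a ^ 2) := by field_simp
  rw [e, Real.log_mul ha.ne' (by positivity)]
  linarith

lemma log_add_le {a t : ℝ} (ha : 0 < a) (ht : 0 ≤ t) :
    Real.log (a + t) ≤ Real.log a + t / a := by
  have e : a + t = a * (1 + t / a) := by field_simp
  rw [e, Real.log_mul ha.ne' (by positivity)]
  have := Real.log_le_sub_one_of_pos (x := 1 + t / a) (by positivity)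
  linarith

/-- The worst positive t is 1, where the decrease is 1/(a(a+1)) ≥ 1/(2a²). This gain offsets the
quadratic error of `neg_log_add_le`. -/
lemma inv_natCast_add_le {a t : ℕ} (ha : 0 < a) :
    ((a + t : ℕ) : ℝ)⁻¹ ≤ (a : ℝ)⁻¹ - 1 / (2 * (a : ℝ) ^ 2) * (1 - if t = 0 then 1 else 0) := by
  rcases Nat.eq_zero_or_pos t with rfl | ht
  · simp
  · rw [if_neg ht.ne']
    have ha' : (1 : ℝ) ≤ a := by exact_mod_cast ha
    have ht' : (1 : ℝ) ≤ t := by exact_mod_cast ht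
    have h1 : (a : ℝ)⁻¹ - 1 / (2 * (a : ℝ) ^ 2) * (1 - 0) = (2 * a - 1) / (2 * a ^ 2) := by
      field_simp
      ring
    rw [h1, inv_eq_one_div, div_le_div_iff₀ (by positivity) (by positivity)]
    push_cast
    nlinarith [mul_nonneg (sub_nonneg.2 ha') (sub_nonneg.2 ht')]

namespace IsIndependentEdgesModel

open TypedGraph

variable {Ω : Type*} {mΩ : MeasurableSpace Ω} {P : Measure Ω} {N : ℕ} {s : ℕ}
  {G₀ : TypedGraph N} {lam : ℕ → Ω → ℝ} {G : ℕ → Ω → TypedGraph N}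

lemma edgesIn_succ (h : IsIndependentEdgesModel P s G₀ lam G) (S : Finset (Fin N)) (n : ℕ)
    (ω : Ω) : (G (n + 1) ω).edgesIn S = (G n ω).edgesIn S +
      ∑ w ∈ Finset.range (s + n), (G (n + 1) ω).multIn S (s + n) w := by
  rw [(h.step n ω).edgesIn_eq (h.notMem_verts n ω), h.verts_eq]

lemma edgesIn_mono (h : IsIndependentEdgesModel P s G₀ lam G) (S : Finset (Fin N)) (ω : Ω) :
    Monotone fun n => (G n ω).edgesIn S :=
  monotone_nat_of_le_succ fun n => by rw [h.edgesIn_succ]; exact Nat.le_add_right _ _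

lemma edgesIn_pos (h : IsIndependentEdgesModel P s G₀ lam G) {S : Finset (Fin N)}
    (hS : S.Nonempty) (n : ℕ) (ω : Ω) : 0 < (G n ω).edgesIn S := by
  refine lt_of_lt_of_le ?_ (h.edgesIn_mono S ω (Nat.zero_le n))
  simp only [h.start]
  exact Finset.sum_pos (fun k _ => h.initial_edges k) hS

lemma rateIn_range (h : IsIndependentEdgesModel P s G₀ lam G) (S : Finset (Fin N)) (n : ℕ)
    (ω : Ω) : (G n ω).rateIn S (Finset.range (s + n)) =
      ((G n ω).edgesIn S : ℝ) / ((G n ω).totalEdges : ℝ) := by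
  rw [← h.verts_eq n ω, rateIn_verts]

lemma rateIn_univ_range (h : IsIndependentEdgesModel P s G₀ lam G) (hN : 1 ≤ N) (n : ℕ)
    (ω : Ω) : (G n ω).rateIn Finset.univ (Finset.range (s + n)) = 1 := by
  have : Nonempty (Fin N) := ⟨⟨0, hN⟩⟩
  have h0 := h.edgesIn_pos (Finset.univ_nonempty (α := Fin N)) n ω
  rw [h.rateIn_range, edgesIn_univ]
  rw [edgesIn_univ] at h0
  exact div_self (by exact_mod_cast h0.ne')

/-- A Lyapunov function for the proportion of the edges with type in `S`. -/
noncomputable def lyapunov (S : Finset (Fin N)) (K : ℝ) (H : TypedGraph N) : ℝ :=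
  Real.log H.totalEdges - Real.log (H.edgesIn S) + K * (H.edgesIn S : ℝ)⁻¹

lemma lyapunov_nonneg (h : IsIndependentEdgesModel P s G₀ lam G) {S : Finset (Fin N)}
    (hS : S.Nonempty) {K : ℝ} (hK : 0 ≤ K) (n : ℕ) (ω : Ω) : 0 ≤ lyapunov S K (G n ω) := by
  have h0 := h.edgesIn_pos hS n ω
  have h1 : Real.log ((G n ω).edgesIn S) ≤ Real.log (G n ω).totalEdges :=
    Real.log_le_log (by exact_mod_cast h0) (by exact_mod_cast (G n ω).edgesIn_le_totalEdges S)
  have h2 : 0 ≤ K * ((G n ω).edgesIn S : ℝ)⁻¹ := by positivity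
  unfold lyapunov
  linarith

variable [IsProbabilityMeasure P] {ν : Measure ℝ} [IsProbabilityMeasure ν]

/-- The number of edges grows linearly. -/
theorem ae_tendsto_totalEdges_div (h : IsIndependentEdgesModel P s G₀ lam G) (hN : 1 ≤ N)
    (hν : ∀ n, P.map (lam (n + 1)) = ν) (hpos : ∀ᵐ x ∂ν, 0 < x)
    (h1 : Integrable (fun x => x) ν) (h2 : Integrable (fun x => x ^ 2) ν) :
    ∀ᵐ ω ∂P, Tendsto (fun n : ℕ => ((G n ω).totalEdges : ℝ) / n) atTop (𝓝 (∫ x, x ∂ν)) := by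
  set ξ : ℕ → Ω → ℝ := fun n ω => ((∑ w ∈ Finset.range (s + n),
    (G (n + 1) ω).multIn Finset.univ (s + n) w : ℕ) : ℝ) with hξ
  have hlaw := ae_tendsto_average_sub_condExp (P := P) (ℱ := h.filtration) (ξ := ξ)
    (C := (∫ x, x ∂ν) + ∫ x, x ^ 2 ∂ν)
    (fun n => (measurable_comp_history G (n + 1) fun H => ((∑ w ∈ Finset.range (s + n),
      H.multIn Finset.univ (s + n) w : ℕ) : ℝ)).stronglyMeasurable)
    (fun n => (memLp_two_iff_integrable_sq (h.measurable_comp (n + 1) fun H =>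
      ((∑ w ∈ Finset.range (s + n), H.multIn Finset.univ (s + n) w : ℕ) :
        ℝ)).aestronglyMeasurable).2
      (h.condExp_sq_sum_multIn hν hpos h1 h2 n Finset.univ subset_rfl).1)
    (fun n => (h.condExp_sq_sum_multIn hν hpos h1 h2 n Finset.univ subset_rfl).2.2)
  have hc : ∀ᵐ ω ∂P, ∀ n, (P[ξ n|h.filtration n]) ω = ∫ x, x ∂ν := by
    rw [ae_all_iff]
    intro n
    refine (h.condExp_sum_multIn hν hpos h1 n Finset.univ subset_rfl).2.mono fun ω hω => ?_
    -- The rate to all vertices over all types is 1, so the conditional mean is constant.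
    simp only [h.rateIn_univ_range hN, mul_one] at hω
    exact hω
  filter_upwards [hlaw, hc] with ω hω hc
  have hE : ∀ n : ℕ, ∑ i ∈ Finset.range n, ξ i ω =
      ((G n ω).totalEdges : ℝ) - (G₀.totalEdges : ℝ) := by
    intro n
    induction n with
    | zero => simp [h.start]
    | succ n ih =>
      rw [Finset.sum_range_succ, ih, ← edgesIn_univ (G (n + 1) ω), h.edgesIn_succ, edgesIn_univ]
      simp only [hξ]
      push_cast
      ring
  have h3 := hω.add_const (∫ x, x ∂ν)
  have h4 := h3.add ((tendsto_inv_atTop_nhds_zero_nat (𝕜 := ℝ)).mul_const (G₀.totalEdges : ℝ))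
  rw [zero_mul, add_zero, zero_add] at h4
  refine h4.congr' ?_
  filter_upwards [eventually_gt_atTop 0] with n hn
  simp only [hc, Finset.sum_sub_distrib, hE, Finset.sum_const, Finset.card_range, nsmul_eq_mul]
  field_simp
  ring

lemma integrable_totalEdges (h : IsIndependentEdgesModel P s G₀ lam G)
    (hν : ∀ n, P.map (lam (n + 1)) = ν) (hpos : ∀ᵐ x ∂ν, 0 < x)
    (h1 : Integrable (fun x => x) ν) (n : ℕ) :
    Integrable (fun ω => ((G n ω).totalEdges : ℝ)) P := by
  induction n with
  | zero => simp only [h.start]; exact integrable_const _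
  | succ n ih =>
    refine (ih.add (h.condExp_sum_multIn hν hpos h1 n Finset.univ subset_rfl).1).congr
      (Eventually.of_forall fun ω => ?_)
    simp only [Pi.add_apply]
    rw [← edgesIn_univ (G (n + 1) ω), h.edgesIn_succ, edgesIn_univ]
    push_cast
    rfl

lemma integrable_lyapunov (h : IsIndependentEdgesModel P s G₀ lam G)
    (hν : ∀ n, P.map (lam (n + 1)) = ν) (hpos : ∀ᵐ x ∂ν, 0 < x)
    (h1 : Integrable (fun x => x) ν) {S : Finset (Fin N)}
    (hS : S.Nonempty) {K : ℝ} (hK : 0 ≤ K) (n : ℕ) :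
    Integrable (fun ω => lyapunov S K (G n ω)) P := by
  refine ((h.integrable_totalEdges hν hpos h1 n).add (integrable_const K)).mono'
    (h.measurable_comp n (lyapunov S K)).aestronglyMeasurable (Eventually.of_forall fun ω => ?_)
  rw [Real.norm_of_nonneg (h.lyapunov_nonneg hS hK n ω)]
  have h0 : (1 : ℝ) ≤ (G n ω).edgesIn S := by exact_mod_cast h.edgesIn_pos hS n ω
  have h2 : Real.log (G n ω).totalEdges ≤ (G n ω).totalEdges :=
    Real.log_le_self (Nat.cast_nonneg _)
  have h3 := Real.log_nonneg h0
  have h4 : K * ((G n ω).edgesIn S : ℝ)⁻¹ ≤ K := mul_le_of_le_one_right hK (inv_le_one_of_one_le₀ h0)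
  simp only [lyapunov, Pi.add_apply]
  linarith

/-- With a edges of type in `S` out of E, and p = a/E, the first-order drifts μ/E and μp/a of the
two logarithms cancel. The error left is at most (μp + μ₂p²)/(2a²). The expected decrease of K/a is
at least K(1 - ψ_0(p))/(2a²), which by convexity is at least Kp(1 - ψ_0(1))/(2a²), and the choice of
`K` makes this dominate. -/
lemma condExp_lyapunov_le (h : IsIndependentEdgesModel P s G₀ lam G) (hN : 1 ≤ N)
    (hν : ∀ n, P.map (lam (n + 1)) = ν) (hpos : ∀ᵐ x ∂ν, 0 < x)
    (h1 : Integrable (fun x => x) ν) (h2 : Integrable (fun x => x ^ 2) ν) {S : Finset (Fin N)}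
    (hS : S.Nonempty) {K : ℝ} (hK0 : 0 ≤ K)
    (hK : (∫ x, x ∂ν) + ∫ x, x ^ 2 ∂ν ≤ K * (1 - mixedPois ν 0 1)) (n : ℕ) :
    P[fun ω => lyapunov S K (G (n + 1) ω)|graphHistory G n] ≤ᵐ[P]
      fun ω => lyapunov S K (G n ω) := by
  set F := graphHistory G n
  have hF : F ≤ mΩ := h.graphHistory_le n
  set r : Finset ℕ := Finset.range (s + n)
  have hμ2 : 0 ≤ ∫ x, x ^ 2 ∂ν := integral_nonneg fun x => sq_nonneg x
  have ha1 : ∀ ω, (1 : ℝ) ≤ (G n ω).edgesIn S := fun ω => by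
    exact_mod_cast h.edgesIn_pos hS n ω
  have hE1 : ∀ ω, (1 : ℝ) ≤ (G n ω).totalEdges := fun ω =>
    (ha1 ω).trans (by exact_mod_cast (G n ω).edgesIn_le_totalEdges S)
  have c1 : HasCondExp F P
      (fun ω => ((∑ w ∈ r, (G (n + 1) ω).multIn Finset.univ (s + n) w : ℕ) : ℝ))
      (fun ω => (∫ x, x ∂ν) * (G n ω).rateIn Finset.univ r) :=
    h.condExp_sum_multIn hν hpos h1 n Finset.univ subset_rfl
  have c2 : HasCondExp F P
      (fun ω => ((∑ w ∈ r, (G (n + 1) ω).multIn S (s + n) w : ℕ) : ℝ))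
      (fun ω => (∫ x, x ∂ν) * (G n ω).rateIn S r) :=
    h.condExp_sum_multIn hν hpos h1 n S subset_rfl
  have c3 : HasCondExp F P
      (fun ω => ((∑ w ∈ r, (G (n + 1) ω).multIn S (s + n) w : ℕ) : ℝ) ^ 2)
      (fun ω => (∫ x, x ∂ν) * (G n ω).rateIn S r + (∫ x, x ^ 2 ∂ν) * (G n ω).rateIn S r ^ 2) :=
    ⟨(h.condExp_sq_sum_multIn hν hpos h1 h2 n S subset_rfl).1,
      (h.condExp_sq_sum_multIn hν hpos h1 h2 n S subset_rfl).2.1⟩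
  have c4 : HasCondExp F P
      (fun ω => if ∑ w ∈ r, (G (n + 1) ω).multIn S (s + n) w = 0 then (1 : ℝ) else 0)
      (fun ω => mixedPois ν 0 ((G n ω).rateIn S r)) := by
    refine ⟨Integrable.of_bound (C := 1) (h.measurable_comp (n + 1) fun H =>
      if ∑ w ∈ r, H.multIn S (s + n) w = 0 then (1 : ℝ) else 0).aestronglyMeasurable
      (Eventually.of_forall fun ω => by split_ifs <;> simp),
      h.condExp_indicator_sum_multIn hν hpos n S subset_rfl 0⟩
  have c0 : HasCondExp F P (fun _ => (1 : ℝ)) (fun _ => 1) :=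
    .of_measurable hF measurable_const (integrable_const _)
  have cf : HasCondExp F P (fun ω => lyapunov S K (G n ω)) (fun ω => lyapunov S K (G n ω)) :=
    .of_measurable hF (measurable_comp_history G n _) (h.integrable_lyapunov hν hpos h1 hS hK0 n)
  have bE : ∀ ω, |((G n ω).totalEdges : ℝ)⁻¹| ≤ 1 := fun ω => by
    rw [abs_of_nonneg (by positivity)]; exact inv_le_one_of_one_le₀ (hE1 ω)
  have ba : ∀ ω, |((G n ω).edgesIn S : ℝ)⁻¹| ≤ 1 := fun ω => by
    rw [abs_of_nonneg (by positivity)]; exact inv_le_one_of_one_le₀ (ha1 ω)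
  have baa : ∀ ω, |1 / (2 * ((G n ω).edgesIn S : ℝ) ^ 2)| ≤ 1 := fun ω => by
    rw [abs_of_nonneg (by positivity)]
    exact div_le_one_of_le₀ (by nlinarith [ha1 ω]) (by positivity)
  have baK : ∀ ω, |K * (1 / (2 * ((G n ω).edgesIn S : ℝ) ^ 2))| ≤ K := fun ω => by
    rw [abs_mul, abs_of_nonneg hK0]
    exact mul_le_of_le_one_right hK0 (baa ω)
  have hR := (((cf.add (c1.mul_left hF (measurable_comp_history G n fun H =>
      (H.totalEdges : ℝ)⁻¹) bE)).sub (c2.mul_left hF (measurable_comp_history G n fun H =>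
      (H.edgesIn S : ℝ)⁻¹) ba)).add (c3.mul_left hF (measurable_comp_history G n fun H =>
      1 / (2 * (H.edgesIn S : ℝ) ^ 2)) baa)).sub ((c0.sub c4).mul_left hF
      (measurable_comp_history G n fun H => K * (1 / (2 * (H.edgesIn S : ℝ) ^ 2))) baK)
  refine (condExp_mono (h.integrable_lyapunov hν hpos h1 hS hK0 (n + 1)) hR.1
    (Eventually.of_forall fun ω => ?_)).trans (hR.2.le.trans (Eventually.of_forall fun ω => ?_))
  · have ha0 := h.edgesIn_pos hS n ω
    have ha : (0 : ℝ) < (G n ω).edgesIn S := by exact_mod_cast ha0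
    have hE : (0 : ℝ) < (G n ω).totalEdges := lt_of_lt_of_le one_pos (hE1 ω)
    have e1 := log_add_le hE (Nat.cast_nonneg (α := ℝ)
      (∑ w ∈ r, (G (n + 1) ω).multIn Finset.univ (s + n) w))
    have e2 := neg_log_add_le ha (Nat.cast_nonneg (α := ℝ)
      (∑ w ∈ r, (G (n + 1) ω).multIn S (s + n) w))
    have e3 := mul_le_mul_of_nonneg_left (inv_natCast_add_le (a := (G n ω).edgesIn S)
      (t := ∑ w ∈ r, (G (n + 1) ω).multIn S (s + n) w) ha0) hK0
    have e4 : ((G (n + 1) ω).totalEdges : ℝ) = (G n ω).totalEdges +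
        ((∑ w ∈ r, (G (n + 1) ω).multIn Finset.univ (s + n) w : ℕ) : ℝ) := by
      rw [← edgesIn_univ (G (n + 1) ω), h.edgesIn_succ, edgesIn_univ, Nat.cast_add]
    simp only [lyapunov]
    rw [e4, h.edgesIn_succ S n ω]
    rw [div_eq_mul_inv] at e1
    rw [Nat.cast_add] at e3 ⊢
    rw [div_eq_mul_inv, div_eq_mul_one_div (_ ^ 2)] at e2
    linarith
  · have ha : (0 : ℝ) < (G n ω).edgesIn S := lt_of_lt_of_le one_pos (ha1 ω)
    have hE : (0 : ℝ) < (G n ω).totalEdges := lt_of_lt_of_le one_pos (hE1 ω)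
    have hp0 := rateIn_nonneg (G n ω) S r
    have hp1 := h.rateIn_le_one n ω S (W := r) subset_rfl
    have hp : ((G n ω).edgesIn S : ℝ)⁻¹ * ((∫ x, x ∂ν) * (G n ω).rateIn S r) =
        ((G n ω).totalEdges : ℝ)⁻¹ * ((∫ x, x ∂ν) * (G n ω).rateIn Finset.univ r) := by
      rw [h.rateIn_univ_range hN, h.rateIn_range]
      field_simp
    have hψ := mixedPois_zero_le hpos hp0 hp1
    beta_reduce
    rw [hp]
    have hfac : (∫ x, x ∂ν) * (G n ω).rateIn S r + (∫ x, x ^ 2 ∂ν) * (G n ω).rateIn S r ^ 2 ≤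
        K * (1 - mixedPois ν 0 ((G n ω).rateIn S r)) := by
      have g1 : (G n ω).rateIn S r ^ 2 ≤ (G n ω).rateIn S r := by nlinarith
      have g2 := mul_le_mul_of_nonneg_left hK hp0
      have g3 := mul_le_mul_of_nonneg_left g1 hμ2
      have g4 := mul_le_mul_of_nonneg_left hψ hK0
      linarith
    have hw : (0 : ℝ) ≤ 1 / (2 * ((G n ω).edgesIn S : ℝ) ^ 2) := by positivity
    have := mul_le_mul_of_nonneg_left hfac hw
    linarith

/-- The proportion of the edges with type in `S` converges to a positive limit. -/
theorem ae_exists_pos_tendsto_rateIn (h : IsIndependentEdgesModel P s G₀ lam G) (hN : 1 ≤ N)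
    (hν : ∀ n, P.map (lam (n + 1)) = ν) (hpos : ∀ᵐ x ∂ν, 0 < x)
    (h1 : Integrable (fun x => x) ν) (h2 : Integrable (fun x => x ^ 2) ν) {S : Finset (Fin N)}
    (hS : S.Nonempty) :
    ∀ᵐ ω ∂P, ∃ p, 0 < p ∧
      Tendsto (fun n => (G n ω).rateIn S (Finset.range (s + n))) atTop (𝓝 p) := by
  have hψ : 0 < 1 - mixedPois ν 0 1 := sub_pos.2 (mixedPois_zero_one_lt hpos)
  have hμ2 : 0 ≤ ∫ x, x ^ 2 ∂ν := integral_nonneg fun x => sq_nonneg x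
  set K := ((∫ x, x ∂ν) + ∫ x, x ^ 2 ∂ν) / (1 - mixedPois ν 0 1) with hKdef
  have hK0 : 0 ≤ K := div_nonneg (add_nonneg (integral_pos_of_ae_pos hpos h1).le hμ2) hψ.le
  have hK : (∫ x, x ∂ν) + ∫ x, x ^ 2 ∂ν ≤ K * (1 - mixedPois ν 0 1) :=
    (div_mul_cancel₀ _ hψ.ne').ge
  have hsup : Supermartingale (fun n ω => lyapunov S K (G n ω)) h.filtration P :=
    supermartingale_nat
      (fun n => (measurable_comp_history G n (lyapunov S K)).stronglyMeasurable)
      (fun n => h.integrable_lyapunov hν hpos h1 hS hK0 n)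
      (fun n => h.condExp_lyapunov_le hN hν hpos h1 h2 hS hK0 hK n)
  -- For a nonnegative supermartingale the L¹ norm is the mean, which never exceeds its initial
  -- value; the sign is flipped to obtain a submartingale.
  have hbdd : ∀ n, eLpNorm ((-fun n ω => lyapunov S K (G n ω)) n) 1 P ≤
      ((∫ ω, lyapunov S K (G 0 ω) ∂P).toNNReal : ENNReal) := by
    intro n
    rw [Pi.neg_apply, eLpNorm_neg, eLpNorm_one_eq_lintegral_enorm,
      ← ofReal_integral_norm_eq_lintegral_enorm (h.integrable_lyapunov hν hpos h1 hS hK0 n)]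
    refine ENNReal.ofReal_le_ofReal ?_
    have := hsup.setIntegral_le (Nat.zero_le n) MeasurableSet.univ
    simp only [Measure.restrict_univ] at this
    refine le_trans (le_of_eq (integral_congr_ae (Eventually.of_forall fun ω => ?_))) this
    exact Real.norm_of_nonneg (h.lyapunov_nonneg hS hK0 n ω)
  filter_upwards [hsup.neg.exists_ae_tendsto_of_bdd hbdd] with ω ⟨c, hc⟩
  -- The correction term converges by itself, since the edge number is monotone; the log-proportion
  -- therefore has a finite limit.
  have hinv : ∃ c', Tendsto (fun n => ((G n ω).edgesIn S : ℝ)⁻¹) atTop (𝓝 c') := by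
    refine ⟨_, tendsto_atTop_ciInf (fun i j hij => ?_) ⟨0, ?_⟩⟩
    · have h0 : (0 : ℝ) < (G i ω).edgesIn S := by exact_mod_cast h.edgesIn_pos hS i ω
      exact inv_anti₀ h0 (by exact_mod_cast h.edgesIn_mono S ω hij)
    · rintro _ ⟨n, rfl⟩
      positivity
  obtain ⟨c', hc'⟩ := hinv
  refine ⟨Real.exp (c + K * c'), Real.exp_pos _, ?_⟩
  have h3 := (Real.continuous_exp.tendsto _).comp (hc.add (hc'.const_mul K))
  refine h3.congr fun n => ?_
  have ha : (0 : ℝ) < (G n ω).edgesIn S := by exact_mod_cast h.edgesIn_pos hS n ω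
  have hE : (0 : ℝ) < (G n ω).totalEdges :=
    lt_of_lt_of_le ha (by exact_mod_cast (G n ω).edgesIn_le_totalEdges S)
  have e : (-fun n ω => lyapunov S K (G n ω)) n ω + K * ((G n ω).edgesIn S : ℝ)⁻¹ =
      Real.log ((G n ω).edgesIn S) - Real.log (G n ω).totalEdges := by
    simp only [Pi.neg_apply, lyapunov]
    ring
  simp only [Function.comp]
  rw [e, Real.exp_sub, Real.exp_log ha, Real.exp_log hE, h.rateIn_range]

end IsIndependentEdgesModel

/-! ### The recursion for the degree distribution -/

/-- With r_n of order 1/n, the quadratic remainder of g contributes O(1/n) after multiplication by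
n. -/
lemma tendsto_natCast_mul_comp {g : ℝ → ℝ} {c K ρ : ℝ} {r : ℕ → ℝ}
    (hg : ∀ x, 0 ≤ x → |g x - c * x| ≤ K * x ^ 2) (hr0 : ∀ n, 0 ≤ r n)
    (hr : Tendsto (fun n : ℕ => (n : ℝ) * r n) atTop (𝓝 ρ)) :
    Tendsto (fun n : ℕ => (n : ℝ) * g (r n)) atTop (𝓝 (c * ρ)) := by
  have hr1 : Tendsto r atTop (𝓝 0) := by
    have := hr.mul (tendsto_inv_atTop_nhds_zero_nat (𝕜 := ℝ))
    rw [mul_zero] at this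
    refine this.congr' ?_
    filter_upwards [eventually_gt_atTop 0] with n hn
    field_simp
  have h0 : Tendsto (fun n : ℕ => K * ((n : ℝ) * r n) * r n) atTop (𝓝 0) := by
    simpa using (hr.const_mul K).mul hr1
  have h1 : Tendsto (fun n : ℕ => (n : ℝ) * g (r n) - c * ((n : ℝ) * r n)) atTop (𝓝 0) := by
    refine squeeze_zero_norm (fun n => ?_) h0
    rw [show (n : ℝ) * g (r n) - c * (n * r n) = n * (g (r n) - c * r n) by ring, norm_mul,
      Real.norm_natCast, Real.norm_eq_abs]
    refine (mul_le_mul_of_nonneg_left (hg _ (hr0 n)) (Nat.cast_nonneg n)).trans_eq ?_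
    ring
  simpa using h1.add (hr.const_mul c)

/-- Strong induction on l. Vertices already of degree l that receive no edge form the contracting
part of the recursion; all other terms come from smaller degrees and converge by induction. -/
lemma tendsto_div_degLimit {ν : Measure ℝ} [IsProbabilityMeasure ν] (hpos : ∀ᵐ x ∂ν, 0 < x)
    (h1 : Integrable (fun x => x) ν) (h2 : Integrable (fun x => x ^ 2) ν) {X d : ℕ → ℕ → ℝ}
    {E p : ℕ → ℝ} {q : ℝ} (hE0 : ∀ n, 0 ≤ E n)
    (hE : Tendsto (fun n : ℕ => E n / n) atTop (𝓝 (∫ x, x ∂ν))) (hp : Tendsto p atTop (𝓝 q))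
    (hd : ∀ l, Tendsto (fun n : ℕ => (n : ℝ)⁻¹ * ∑ i ∈ Finset.range n, d l i) atTop (𝓝 0))
    (hX : ∀ l n, X l (n + 1) = ∑ ij ∈ Finset.HasAntidiagonal.antidiagonal l,
      X ij.1 n * mixedPois ν ij.2 ((ij.1 : ℝ) / (2 * E n)) + mixedPois ν l (p n) + d l n) (l : ℕ) :
    Tendsto (fun n : ℕ => X l n / n) atTop (𝓝 (degLimit (fun j => mixedPois ν j q) l)) := by
  have hμ := integral_pos_of_ae_pos hpos h1
  have hr : ∀ i : ℕ, Tendsto (fun n : ℕ => (n : ℝ) * ((i : ℝ) / (2 * E n))) atTop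
      (𝓝 ((i : ℝ) / 2 * (∫ x, x ∂ν)⁻¹)) := by
    intro i
    refine ((hE.inv₀ hμ.ne').const_mul ((i : ℝ) / 2)).congr fun n => ?_
    rw [inv_div]
    ring
  have hr0 : ∀ i n : ℕ, 0 ≤ (i : ℝ) / (2 * E n) := fun i n =>
    div_nonneg (Nat.cast_nonneg i) (mul_nonneg zero_le_two (hE0 n))
  have hzero : ∀ i : ℕ, Tendsto (fun n : ℕ => (n : ℝ) * (1 - mixedPois ν 0 ((i : ℝ) / (2 * E n))))
      atTop (𝓝 ((i : ℝ) / 2)) := fun i => by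
    convert tendsto_natCast_mul_comp (g := fun x => 1 - mixedPois ν 0 x)
      (fun x hx => abs_one_sub_mixedPois_zero_sub_le hpos h1 h2 hx) (hr0 i) (hr i) using 2
    field_simp
  have hone : ∀ i : ℕ, Tendsto (fun n : ℕ => (n : ℝ) * mixedPois ν 1 ((i : ℝ) / (2 * E n)))
      atTop (𝓝 ((i : ℝ) / 2)) := fun i => by
    convert tendsto_natCast_mul_comp (g := mixedPois ν 1)
      (fun x hx => abs_mixedPois_one_sub_le hpos h1 h2 hx) (hr0 i) (hr i) using 2
    field_simp
  have htwo : ∀ i j : ℕ, Tendsto (fun n : ℕ => (n : ℝ) *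
      mixedPois ν (j + 2) ((i : ℝ) / (2 * E n))) atTop (𝓝 0) := fun i j => by
    have := tendsto_natCast_mul_comp (g := mixedPois ν (j + 2)) (c := 0)
      (K := ∫ x, x ^ 2 ∂ν) (fun x hx => by
        rw [zero_mul, sub_zero, abs_of_nonneg (mixedPois_nonneg _ _)]
        exact mixedPois_add_two_le hpos h2 j hx) (hr0 i) (hr i)
    rwa [zero_mul] at this
  have hq : ∀ l, Tendsto (fun n => mixedPois ν l (p n)) atTop (𝓝 (mixedPois ν l q)) := fun l =>
    ((continuous_mixedPois l).tendsto q).comp hp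
  induction l using Nat.strong_induction_on with
  | _ l ih =>
    cases l with
    | zero =>
      have := tendsto_div_of_recursion (u := X 0) (a := 0) le_rfl
        (fun n => mixedPois_nonneg (ν := ν) 0 (((0 : ℕ) : ℝ) / (2 * E n)))
        (fun n => mixedPois_le_one _ _) (by simpa only [Nat.cast_zero, zero_div] using hzero 0)
        (hq 0) (hd 0)
        (fun n => by
          rw [hX, Finset.Nat.antidiagonal_zero, Finset.sum_singleton]
          ring)
      simpa [degLimit] using this
    | succ m =>
      -- Only one new edge at a vertex of degree m survives in the limit; gains of two or more edges
      -- have vanishing rate.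
      have hb : Tendsto (fun n => ∑ ij ∈ Finset.HasAntidiagonal.antidiagonal m,
          X ij.1 n * mixedPois ν (ij.2 + 1) ((ij.1 : ℝ) / (2 * E n)) + mixedPois ν (m + 1) (p n))
          atTop (𝓝 (degLimit (fun j => mixedPois ν j q) m * ((m : ℝ) / 2) +
            mixedPois ν (m + 1) q)) := by
        refine Tendsto.add ?_ (hq (m + 1))
        have hs : Tendsto (fun n => ∑ ij ∈ Finset.HasAntidiagonal.antidiagonal m,
            X ij.1 n * mixedPois ν (ij.2 + 1) ((ij.1 : ℝ) / (2 * E n))) atTop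
            (𝓝 (∑ ij ∈ Finset.HasAntidiagonal.antidiagonal m, if ij = (m, 0) then
              degLimit (fun j => mixedPois ν j q) m * ((m : ℝ) / 2) else 0)) := by
          refine tendsto_finsetSum _ fun ij hij => ?_
          obtain ⟨i, j⟩ := ij
          have hij' : i + j = m := Finset.HasAntidiagonal.mem_antidiagonal.1 hij
          have hi := ih i (by omega)
          have aux : ∀ c, Tendsto (fun n : ℕ => (n : ℝ) *
              mixedPois ν (j + 1) ((i : ℝ) / (2 * E n))) atTop (𝓝 c) →
              Tendsto (fun n => X i n * mixedPois ν (j + 1) ((i : ℝ) / (2 * E n))) atTop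
                (𝓝 (degLimit (fun j => mixedPois ν j q) i * c)) := by
            intro c hc
            refine (hi.mul hc).congr' ?_
            filter_upwards [eventually_gt_atTop 0] with n hn
            field_simp
          rcases j with _ | j
          · obtain rfl : i = m := hij'
            rw [if_pos rfl]
            exact aux _ (hone i)
          · rw [if_neg (by simp)]
            simpa using aux 0 (htwo i j)
        rwa [Finset.sum_ite_eq' , if_pos (by simp)] at hs
      have := tendsto_div_of_recursion (u := X (m + 1)) (a := ((m + 1 : ℕ) : ℝ) / 2)
        (by positivity)
        (fun n => mixedPois_nonneg (ν := ν) 0 (((m + 1 : ℕ) : ℝ) / (2 * E n)))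
        (fun n => mixedPois_le_one _ _) (hzero (m + 1)) hb (hd (m + 1)) (fun n => by
          -- Splits off the pair (m + 1, 0), whose weight is the contraction factor.
          rw [hX, Finset.Nat.antidiagonal_succ', Finset.sum_cons, Finset.sum_map]
          simp only [Function.Embedding.prodMap, Function.Embedding.coeFn_mk, Prod.map,
            Function.Embedding.refl_apply, Nat.succ_eq_add_one]
          ring)
      convert this using 2
      rw [degLimit]
      push_cast
      field_simp
      ring

/-! ### Vertices of a given degree -/

/-- Separates the old degree, known from the history, from the new edges, whose conditional law is
known. -/
lemma ite_add_eq_sum_antidiagonal (D T l : ℕ) :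
    (if D + T = l then (1 : ℝ) else 0) = ∑ ij ∈ Finset.HasAntidiagonal.antidiagonal l,
      (if D = ij.1 then 1 else 0) * (if T = ij.2 then 1 else 0) := by
  have : ∀ ij : ℕ × ℕ, (if D = ij.1 then (1 : ℝ) else 0) * (if T = ij.2 then 1 else 0) =
      if ij = (D, T) then 1 else 0 := by
    rintro ⟨i, j⟩
    by_cases h1 : D = i <;> by_cases h2 : T = j <;> simp [h1, h2, eq_comm]
  simp only [this, Finset.sum_ite_eq', Finset.HasAntidiagonal.mem_antidiagonal]

lemma abs_ite_add_sub_ite_le (D T l : ℕ) :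
    |(if D + T = l then (1 : ℝ) else 0) - (if D = l then 1 else 0)| ≤ T := by
  rcases Nat.eq_zero_or_pos T with rfl | hT
  · simp
  · have hT' : (1 : ℝ) ≤ T := by exact_mod_cast hT
    refine le_trans ?_ hT'
    split_ifs <;> simp

namespace IsIndependentEdgesModel

open TypedGraph

variable {Ω : Type*} {mΩ : MeasurableSpace Ω} {P : Measure Ω} {N : ℕ} {s : ℕ}
  {G₀ : TypedGraph N} {lam : ℕ → Ω → ℝ} {G : ℕ → Ω → TypedGraph N}

lemma numDegIn_eq_sum (h : IsIndependentEdgesModel P s G₀ lam G) (S : Finset (Fin N)) (l n : ℕ)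
    (ω : Ω) : ((G n ω).numDegIn S l : ℝ) =
      ∑ v ∈ Finset.range (s + n), if (G n ω).degIn S v = l then (1 : ℝ) else 0 := by
  rw [numDegIn, h.verts_eq, Finset.card_filter]
  push_cast
  rfl

/-- The sum over `{v}` is kept so that the conditional law for a general vertex set applies with W =
{v}. -/
lemma numDegIn_succ (h : IsIndependentEdgesModel P s G₀ lam G) (S : Finset (Fin N)) (l n : ℕ)
    (ω : Ω) : ((G (n + 1) ω).numDegIn S l : ℝ) =
      ∑ v ∈ Finset.range (s + n), (if (G n ω).degIn S v +
        ∑ w ∈ {v}, (G (n + 1) ω).multIn S (s + n) w = l then (1 : ℝ) else 0) +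
      if ∑ w ∈ Finset.range (s + n), (G (n + 1) ω).multIn S (s + n) w = l then 1 else 0 := by
  rw [h.numDegIn_eq_sum, ← add_assoc, Finset.sum_range_succ,
    (h.step n ω).degIn_new (h.notMem_verts n ω), h.verts_eq]
  congr 1
  refine Finset.sum_congr rfl fun v hv => ?_
  rw [(h.step n ω).degIn_eq (h.notMem_verts n ω) S (by rwa [h.verts_eq]), Finset.sum_singleton]

/-- An old vertex changes degree only by receiving an edge, and the new vertex adds at most one: the
increments inherit a uniform second-moment bound. -/
lemma abs_numDegIn_sub_le (h : IsIndependentEdgesModel P s G₀ lam G) (S : Finset (Fin N))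
    (l n : ℕ) (ω : Ω) :
    |((G (n + 1) ω).numDegIn S l : ℝ) - ((G n ω).numDegIn S l : ℝ)| ≤
      ((∑ w ∈ Finset.range (s + n), (G (n + 1) ω).multIn S (s + n) w : ℕ) : ℝ) + 1 := by
  rw [h.numDegIn_succ, h.numDegIn_eq_sum, add_sub_right_comm, ← Finset.sum_sub_distrib]
  refine (abs_add_le _ _).trans (add_le_add ?_ ?_)
  · rw [Nat.cast_sum]
    refine (Finset.abs_sum_le_sum_abs _ _).trans (Finset.sum_le_sum fun v _ => ?_)
    rw [Finset.sum_singleton]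
    exact abs_ite_add_sub_ite_le _ _ _
  · split_ifs <;> simp

variable [IsProbabilityMeasure P] {ν : Measure ℝ} [IsProbabilityMeasure ν]

lemma hasCondExp_numDegIn (h : IsIndependentEdgesModel P s G₀ lam G)
    (hν : ∀ n, P.map (lam (n + 1)) = ν) (hpos : ∀ᵐ x ∂ν, 0 < x) (S : Finset (Fin N)) (l n : ℕ) :
    HasCondExp (graphHistory G n) P (fun ω => ((G (n + 1) ω).numDegIn S l : ℝ))
      (fun ω => ∑ ij ∈ Finset.HasAntidiagonal.antidiagonal l, ((G n ω).numDegIn S ij.1 : ℝ) *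
          mixedPois ν ij.2 ((ij.1 : ℝ) / (2 * ((G n ω).totalEdges : ℝ))) +
        mixedPois ν l ((G n ω).rateIn S (Finset.range (s + n)))) := by
  have hF := h.graphHistory_le n
  have hind : ∀ (W : Finset ℕ), W ⊆ Finset.range (s + n) → ∀ j, HasCondExp (graphHistory G n) P
      (fun ω => if ∑ w ∈ W, (G (n + 1) ω).multIn S (s + n) w = j then (1 : ℝ) else 0)
      (fun ω => mixedPois ν j ((G n ω).rateIn S W)) := fun W hW j =>
    ⟨Integrable.of_bound (C := 1) (h.measurable_comp (n + 1) fun H =>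
      if ∑ w ∈ W, H.multIn S (s + n) w = j then (1 : ℝ) else 0).aestronglyMeasurable
      (Eventually.of_forall fun ω => by split_ifs <;> simp),
      h.condExp_indicator_sum_multIn hν hpos n S hW j⟩
  have key := (HasCondExp.sum (I := Finset.range (s + n)) fun v hv =>
    HasCondExp.sum (I := Finset.HasAntidiagonal.antidiagonal l) fun ij _ =>
      (hind {v} (Finset.singleton_subset_iff.2 hv) ij.2).mul_left hF (C := 1)
        (measurable_comp_history G n fun H => if H.degIn S v = ij.1 then (1 : ℝ) else 0)
        (fun ω => by split_ifs <;> simp)).add (hind (Finset.range (s + n)) subset_rfl l)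
  convert key using 2 with ω ω
  · rw [h.numDegIn_succ]
    simp only [ite_add_eq_sum_antidiagonal]
  · congr 1
    rw [Finset.sum_comm]
    refine Finset.sum_congr rfl fun ij _ => ?_
    rw [h.numDegIn_eq_sum, Finset.sum_mul]
    refine Finset.sum_congr rfl fun v _ => ?_
    -- The rate of a vertex depends only on its degree, so vertices of equal degree can be grouped.
    split_ifs with hv
    · rw [rateIn, Finset.sum_singleton, hv]
    · simp

/-- The fractions of vertices with a given degree converge if the proportion of the edges with the
types in question converges. -/
theorem ae_tendsto_numDegIn_div (h : IsIndependentEdgesModel P s G₀ lam G) (hN : 1 ≤ N)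
    (hν : ∀ n, P.map (lam (n + 1)) = ν) (hpos : ∀ᵐ x ∂ν, 0 < x)
    (h1 : Integrable (fun x => x) ν) (h2 : Integrable (fun x => x ^ 2) ν) {S : Finset (Fin N)}
    {p : Ω → ℝ} (hp : ∀ᵐ ω ∂P,
      Tendsto (fun n => (G n ω).rateIn S (Finset.range (s + n))) atTop (𝓝 (p ω))) :
    ∀ᵐ ω ∂P, ∀ l, Tendsto (fun n => ((G n ω).numDegIn S l : ℝ) / ((G n ω).verts.card : ℝ)) atTop
      (𝓝 (degLimit (fun j => mixedPois ν j (p ω)) l)) := by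
  set ξ : ℕ → ℕ → Ω → ℝ := fun l n ω =>
    ((G (n + 1) ω).numDegIn S l : ℝ) - ((G n ω).numDegIn S l : ℝ) with hξ
  have hξm : ∀ l n, Measurable[graphHistory G (n + 1)] (ξ l n) := fun l n =>
    (measurable_comp_history G (n + 1) fun H => (H.numDegIn S l : ℝ)).sub
      ((measurable_comp_history G n fun H => (H.numDegIn S l : ℝ)).mono
        (h.filtration.mono n.le_succ) le_rfl)
  have hξsq : ∀ l n ω, ξ l n ω ^ 2 ≤ 2 *
      ((∑ w ∈ Finset.range (s + n), (G (n + 1) ω).multIn S (s + n) w : ℕ) : ℝ) ^ 2 + 2 := by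
    intro l n ω
    have := sq_le_sq' (neg_le_of_abs_le (h.abs_numDegIn_sub_le S l n ω))
      (le_of_abs_le (h.abs_numDegIn_sub_le S l n ω))
    refine this.trans ?_
    nlinarith [sq_nonneg (((∑ w ∈ Finset.range (s + n),
      (G (n + 1) ω).multIn S (s + n) w : ℕ) : ℝ) - 1)]
  have hbi : ∀ n, Integrable (fun ω => 2 * ((∑ w ∈ Finset.range (s + n),
      (G (n + 1) ω).multIn S (s + n) w : ℕ) : ℝ) ^ 2 + 2) P := fun n =>
    ((h.condExp_sq_sum_multIn hν hpos h1 h2 n S subset_rfl).1.const_mul 2).add (integrable_const _)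
  have hξi : ∀ l n, Integrable (fun ω => ξ l n ω ^ 2) P := fun l n =>
    (hbi n).mono' (((hξm l n).mono (h.graphHistory_le _) le_rfl).pow_const 2).aestronglyMeasurable
      (Eventually.of_forall fun ω => by
        rw [Real.norm_of_nonneg (sq_nonneg _)]
        exact hξsq l n ω)
  have hlaw : ∀ l, ∀ᵐ ω ∂P, Tendsto (fun n : ℕ => (n : ℝ)⁻¹ *
      ∑ i ∈ Finset.range n, (ξ l i ω - (P[ξ l i|h.filtration i]) ω)) atTop (𝓝 0) := fun l => by
    refine ae_tendsto_average_sub_condExp (P := P) (ℱ := h.filtration) (ξ := ξ l)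
      (C := 2 * ((∫ x, x ∂ν) + ∫ x, x ^ 2 ∂ν) + 2) (fun n => (hξm l n).stronglyMeasurable)
      (fun n => (memLp_two_iff_integrable_sq
        ((hξm l n).mono (h.graphHistory_le _) le_rfl).aestronglyMeasurable).2 (hξi l n))
      (fun n => ?_)
    refine (integral_mono (hξi l n) (hbi n) (hξsq l n)).trans ?_
    rw [integral_add ((h.condExp_sq_sum_multIn hν hpos h1 h2 n S subset_rfl).1.const_mul 2)
      (integrable_const _), integral_const_mul]
    have := (h.condExp_sq_sum_multIn hν hpos h1 h2 n S subset_rfl).2.2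
    simp only [integral_const, probReal_univ, one_smul]
    linarith
  have hcond : ∀ l n, P[ξ l n|h.filtration n] =ᵐ[P] fun ω =>
      ∑ ij ∈ Finset.HasAntidiagonal.antidiagonal l, ((G n ω).numDegIn S ij.1 : ℝ) *
          mixedPois ν ij.2 ((ij.1 : ℝ) / (2 * ((G n ω).totalEdges : ℝ))) +
        mixedPois ν l ((G n ω).rateIn S (Finset.range (s + n))) - (G n ω).numDegIn S l := by
    intro l n
    have hi : Integrable (fun ω => ((G n ω).numDegIn S l : ℝ)) P := by
      refine Integrable.of_bound (C := ((s + n : ℕ) : ℝ))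
        (h.measurable_comp n fun H => (H.numDegIn S l : ℝ)).aestronglyMeasurable
        (Eventually.of_forall fun ω => ?_)
      rw [Real.norm_natCast]
      have := Finset.card_filter_le (G n ω).verts fun v => (G n ω).degIn S v = l
      rw [h.verts_eq, Finset.card_range] at this
      rw [numDegIn, h.verts_eq]
      exact_mod_cast this
    exact ((h.hasCondExp_numDegIn hν hpos S l n).sub (HasCondExp.of_measurable
      (h.graphHistory_le n) (measurable_comp_history G n fun H => (H.numDegIn S l : ℝ)) hi)).2
  filter_upwards [ae_all_iff.2 hlaw, ae_all_iff.2 fun l => ae_all_iff.2 (hcond l),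
    h.ae_tendsto_totalEdges_div hN hν hpos h1 h2, hp] with ω h3 h4 h5 h6 l
  have h7 := tendsto_div_degLimit hpos h1 h2 (X := fun l n => ((G n ω).numDegIn S l : ℝ))
    (d := fun l n => ξ l n ω - (P[ξ l n|h.filtration n]) ω)
    (E := fun n => ((G n ω).totalEdges : ℝ)) (fun n => Nat.cast_nonneg _) h5 h6 h3
    (fun l n => by
      rw [h4]
      simp only [hξ]
      ring) l
  -- Passes from division by n to division by the number n + s of vertices.
  have h8 := h7.mul (tendsto_natCast_div_add_atTop (s : ℝ))
  rw [mul_one] at h8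
  refine h8.congr' ?_
  filter_upwards [eventually_gt_atTop 0] with n hn
  rw [h.verts_eq, Finset.card_range]
  push_cast
  field_simp
  ring

end IsIndependentEdgesModel

/-! ### Measurability of the limits and the main theorem -/

lemma measurable_degLimit {α : Type*} [MeasurableSpace α] {q : ℕ → α → ℝ}
    (hq : ∀ l, Measurable (q l)) (l : ℕ) : Measurable fun a => degLimit (fun j => q j a) l := by
  induction l with
  | zero => exact hq 0
  | succ l ih =>
    simp only [degLimit]
    exact ((ih.const_mul _).add ((hq (l + 1)).const_mul 2)).div_const _

theorem mainTheorem5 {Ω : Type*} [MeasurableSpace Ω] (P : Measure Ω) [IsProbabilityMeasure P]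
    (N : ℕ) (hN : 1 ≤ N) (s : ℕ) (G₀ : TypedGraph N)
    (lam : ℕ → Ω → ℝ) (G : ℕ → Ω → TypedGraph N)
    (hmodel : IsIndependentEdgesModel P s G₀ lam G)
    (hident : ∀ n, IdentDistrib (lam (n + 1)) (lam 1) P P)
    (hmoment : ∀ p : ℕ, Integrable (fun ω => lam 1 ω ^ p) P)
    (hseries : ∃ z : ℝ, 1 < z ∧ Summable (fun l : ℕ =>
      (∫ ω, lam 1 ω ^ (l + 1) ∂P) / (((l + 1 : ℕ) : ℝ) * ((l + 1)! : ℝ)) * z ^ (l + 1))) :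
    (∀ k : Fin N, ∃ (x : ℕ → Ω → ℝ) (C : Ω → ℝ),
      (∀ l, Measurable (x l)) ∧ Measurable C ∧
      (∀ l, ∀ᵐ ω ∂P, Tendsto
        (fun n => ((G n ω).numTypeDeg k l : ℝ) / ((G n ω).verts.card : ℝ)) atTop (𝓝 (x l ω))) ∧
      (∀ᵐ ω ∂P, HasSum (fun l => x l ω) 1) ∧
      (∀ᵐ ω ∂P, 0 < C ω ∧ Tendsto (fun l : ℕ => x l ω * (l : ℝ) ^ 3) atTop (𝓝 (C ω)))) ∧
    (∃ (z : ℕ → ℝ) (C : ℝ),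
      (∀ d, ∀ᵐ ω ∂P, Tendsto
        (fun n => ((G n ω).numTotalDeg d : ℝ) / ((G n ω).verts.card : ℝ)) atTop (𝓝 (z d))) ∧
      HasSum z 1 ∧
      0 < C ∧ Tendsto (fun d : ℕ => z d * (d : ℝ) ^ 3) atTop (𝓝 C)) := by
  have hlam : Measurable (lam 1) := hmodel.measurable_lam 1
  set ν : Measure ℝ := P.map (lam 1) with hνdef
  have hνp : IsProbabilityMeasure ν := Measure.isProbabilityMeasure_map hlam.aemeasurable
  have hν : ∀ n, P.map (lam (n + 1)) = ν := fun n => (hident n).map_eq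
  have hpos : ∀ᵐ x ∂ν, 0 < x :=
    (ae_map_iff hlam.aemeasurable measurableSet_Ioi).2 (hmodel.lam_pos 0)
  have h1 : Integrable (fun x => x) ν :=
    (integrable_map_measure aestronglyMeasurable_id hlam.aemeasurable).2
      (by simpa using hmoment 1)
  have h2 : Integrable (fun x => x ^ 2) ν :=
    (integrable_map_measure (by fun_prop) hlam.aemeasurable).2 (hmoment 2)
  have hμ := integral_pos_of_ae_pos hpos h1
  have hμ2 : 0 ≤ ∫ x, x ^ 2 ∂ν := integral_nonneg fun x => sq_nonneg x
  have hC : ∀ p, 0 < p → 0 < 2 * (2 * (∫ x, x ∂ν) * p + (∫ x, x ^ 2 ∂ν) * p ^ 2) := fun p hp => by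
    positivity
  constructor
  · intro k
    have hex := hmodel.ae_exists_pos_tendsto_rateIn hN hν hpos h1 h2 (Finset.singleton_nonempty k)
    -- The pointwise limits are replaced by a measurable version, so that the limiting fractions and
    -- the tail constant are random variables.
    obtain ⟨p, hpm, hp⟩ := measurable_limit_of_tendsto_metrizable_ae
      (f := fun n ω => (G n ω).rateIn {k} (Finset.range (s + n))) (L := atTop)
      (fun n => (hmodel.measurable_comp n fun H =>
        H.rateIn {k} (Finset.range (s + n))).aemeasurable)
      (hex.mono fun ω ⟨p, _, hp⟩ => ⟨p, hp⟩)
    have hp0 : ∀ᵐ ω ∂P, 0 < p ω := by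
      filter_upwards [hex, hp] with ω ⟨q, hq0, hq⟩ hpω
      rwa [tendsto_nhds_unique hpω hq]
    refine ⟨fun l ω => degLimit (fun j => mixedPois ν j (p ω)) l,
      fun ω => 2 * (2 * (∫ x, x ∂ν) * p ω + (∫ x, x ^ 2 ∂ν) * p ω ^ 2),
      measurable_degLimit fun j => (continuous_mixedPois j).measurable.comp hpm,
      ((hpm.const_mul _).add ((hpm.pow_const 2).const_mul _)).const_mul 2, fun l => ?_, ?_, ?_⟩
    · filter_upwards [hmodel.ae_tendsto_numDegIn_div hN hν hpos h1 h2 hp] with ω hω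
      simpa only [TypedGraph.numDegIn, TypedGraph.degIn, Finset.sum_singleton,
        TypedGraph.numTypeDeg] using hω l
    · filter_upwards [hp0] with ω hω
      exact hasSum_degLimit (fun l => mixedPois_nonneg _ _) (hasSum_mixedPois hpos hω.le)
        (hasSum_mul_mixedPois hpos h1 h2 hω.le)
    · filter_upwards [hp0] with ω hω
      exact ⟨hC _ hω, tendsto_degLimit_mul_cube (hasSum_mul_mixedPois hpos h1 h2 hω.le)⟩
  · have hM := hasSum_mul_mixedPois hpos h1 h2 zero_le_one
    refine ⟨degLimit fun j => mixedPois ν j 1, _, fun d => ?_,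
      hasSum_degLimit (fun l => mixedPois_nonneg _ _) (hasSum_mixedPois hpos zero_le_one) hM,
      hC 1 one_pos, tendsto_degLimit_mul_cube hM⟩
    -- Over all types the proportion is identically 1, which is why these limits are deterministic.
    have hp : ∀ᵐ ω ∂P, Tendsto (fun n => (G n ω).rateIn Finset.univ (Finset.range (s + n))) atTop
        (𝓝 1) := Eventually.of_forall fun ω => by
      simp only [hmodel.rateIn_univ_range hN]
      exact tendsto_const_nhds
    filter_upwards [hmodel.ae_tendsto_numDegIn_div hN hν hpos h1 h2 hp] with ω hω
    exact hω d
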